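/- For a positive integer $N$ and $\alpha\in\mathbb{R}$ let $\operatorname{e}(\alpha)=e^{2\pi i\alpha}$ and $F_N(\alpha)=\sum_{n\le N}\Omega(n)\operatorname{e}(\alpha n)$, where $\Omega(n)$ is the number of prime factors of $n$ counted with multiplicity. Let $B>0$ and put $Q=(\log N)^B$. Let $\mathfrak{M}$ be the union, over all integers $1\le q\le Q$ and $0\le a\le q$ with $\gcd(a,q)=1$, of the sets $\{\alpha\in[0,1] : |\alpha-a/q|\le Q/N\}$ (the major arcs), and let $\mathfrak{m}=[0,1]\setminus\mathfrak{M}$ (the minor arcs). Theorem. For every $B>0$ there are constants $C>0$ and $N_0$, depending only on $B$, such that for every $\Delta\in(0,\tfrac12)$ and every integer $N\ge N_0$, $$\left|\int_{\mathfrak{m}} F_N(\alpha)^3\operatorname{e}(-\alpha N)\,d\alpha\right| \le C\,\frac{N^2(\log\log N)^2}{(\log N)^{B\Delta-4}}.$$ -/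

import Mathlib

/-- The additive character `e(θ) = exp(2πiθ)`. -/
noncomputable def e (θ : ℝ) : ℂ :=
  Complex.exp (2 * Real.pi * Complex.I * θ)

/-- `F_N(α) = ∑_{n ≤ N} Ω(n) e(αn)`, where `Ω(n)` is the number of prime factors of `n`
counted with multiplicity. -/
noncomputable def F (N : ℕ) (α : ℝ) : ℂ :=
  ∑ n ∈ Finset.Icc 1 N, (ArithmeticFunction.cardFactors n : ℂ) * e (α * n)

/-- The size parameter `Q = (log N)^B`. -/
noncomputable def arcParam (B : ℝ) (N : ℕ) : ℝ :=
  Real.log N ^ B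

/-- The major arc `𝔐(q, a)`: all `α ∈ [0, 1]` with `|α - a / q| ≤ Q / N`. -/
def majorArc (B : ℝ) (N q a : ℕ) : Set ℝ :=
  {α : ℝ | α ∈ Set.Icc (0 : ℝ) 1 ∧ |α - (a : ℝ) / (q : ℝ)| ≤ arcParam B N / (N : ℝ)}

/-- The union `𝔐` of the major arcs `𝔐(q, a)` over `1 ≤ q ≤ Q`, `0 ≤ a ≤ q`, `(a, q) = 1`. -/
def majorArcs (B : ℝ) (N : ℕ) : Set ℝ :=
  {α : ℝ | ∃ q a : ℕ, 1 ≤ q ∧ (q : ℝ) ≤ arcParam B N ∧ a ≤ q ∧ Nat.Coprime a q ∧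
    α ∈ majorArc B N q a}

/-- The minor arcs `𝔪 = [0, 1] \ 𝔐`. -/
def minorArcs (B : ℝ) (N : ℕ) : Set ℝ :=
  Set.Icc (0 : ℝ) 1 \ majorArcs B N

/-! On the minor arcs one factor of `F` is bounded by its supremum and the other two by Parseval.
Write `ℓ = 1 + log 2N`. Since `Ω(n) ≤ log₂ N + 1` for `n ≤ N`, the mean square of `F` is `≪ N ℓ²`.
So everything rests on `norm_F_le`: `F ≪ N ℓ² / √Q` on the minor arcs. The integral is then `≪ N²
(log N)^4 / (log N)^(B/2)`, which suffices because `Δ < 1/2`; the factor `(log log N)²` is merely at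
least `1`.

For the supremum, `Ω` is expanded over prime powers, so `F` becomes a sum of geometric sums over the
multiples of `p^k`. Put `D = ⌊N/Q⌋`. Prime powers up to `D` form a type I sum, controlled by the
spacing of the points `αd` modulo one. Prime powers above `D` with `k ≥ 2` are few and are bounded
trivially.

Primes above `D` are handled without Vaughan's identity. As `(D+1)² > N`, each `n ≤ N` has at most
one such prime factor, so their contribution is the sum of `e(αn)` over all `n ≤ N` minus the sum
over the `n` whose prime factors are all at most `D`.

In this last sum Ramaré's weights on the primes in `(⌊Q⌋, D]` extract a factor `n = pm`, giving a
bilinear form treated by Cauchy–Schwarz. The weights fail only for `⌊Q⌋`-smooth `n` (Rankin's bound)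
and for `n` divisible by `p²` with `p > ⌊Q⌋`. -/

/-! ### The additive character and geometric sums. -/

/-- The distance of a real number to the nearest integer. -/
noncomputable def distInt (x : ℝ) : ℝ := |x - round x|

lemma distInt_nonneg (x : ℝ) : 0 ≤ distInt x := abs_nonneg _

lemma e_add (x y : ℝ) : e (x + y) = e x * e y := by
  simp only [e, ← Complex.exp_add]
  congr 1
  push_cast
  ring

lemma e_eq_exp_mul_I (x : ℝ) : e x = Complex.exp (Complex.I * ((2 * Real.pi * x : ℝ) : ℂ)) := by
  unfold e
  congr 1
  push_cast
  ring

lemma norm_e (x : ℝ) : ‖e x‖ = 1 := by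
  rw [e_eq_exp_mul_I, mul_comm]
  exact Complex.norm_exp_ofReal_mul_I _

lemma e_intCast (n : ℤ) : e n = 1 := by
  rw [e, Complex.exp_eq_one_iff]
  exact ⟨n, by push_cast; ring⟩

lemma e_sub_round (x : ℝ) : e (x - round x) = e x := by
  have h := e_add (x - round x) (round x)
  rw [sub_add_cancel, e_intCast, mul_one] at h
  exact h.symm

lemma conj_e (x : ℝ) : (starRingEnd ℂ) (e x) = e (-x) := by
  rw [e, e, ← Complex.exp_conj]
  congr 1
  simp [Complex.conj_ofNat]

lemma continuous_e : Continuous e := by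
  unfold e
  fun_prop

/-- `|e(x) - 1| = 2 |sin πx| ≥ 4 ‖x‖`. -/
lemma four_mul_distInt_le_norm (x : ℝ) : 4 * distInt x ≤ ‖e x - 1‖ := by
  rw [← e_sub_round x, e_eq_exp_mul_I, Complex.norm_exp_I_mul_ofReal_sub_one, norm_mul,
    Real.norm_ofNat, Real.norm_eq_abs]
  have h1 : |x - round x| ≤ 1 / 2 := abs_sub_round x
  have hpi := Real.pi_pos
  have h2 : |2 * Real.pi * (x - round x) / 2| = Real.pi * |x - round x| := by
    rw [show 2 * Real.pi * (x - round x) / 2 = Real.pi * (x - round x) by ring, abs_mul,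
      abs_of_pos hpi]
  have h3 := Real.mul_abs_le_abs_sin (x := 2 * Real.pi * (x - round x) / 2)
    (by rw [h2]; nlinarith)
  rw [h2] at h3
  have h4 : 2 / Real.pi * (Real.pi * |x - round x|) = 2 * |x - round x| := by
    field_simp
  unfold distInt
  linarith

lemma e_sub_one_mul_sum_Ioc (β : ℝ) {a b : ℕ} (hab : a ≤ b) :
    (e β - 1) * ∑ n ∈ Finset.Ioc a b, e (β * n) = e (β * (b + 1 : ℝ)) - e (β * (a + 1 : ℝ)) := by
  induction b, hab using Nat.le_induction with
  | base => simp
  | succ b hab ih =>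
    rw [Finset.sum_Ioc_succ_top (by omega), mul_add, ih]
    have : e (β * ((b + 1 : ℕ) + 1 : ℝ)) = e β * e (β * ((b + 1 : ℕ) : ℝ)) := by
      rw [← e_add]; congr 1; ring
    rw [this]
    push_cast
    ring

/-- The geometric sum formula, kept in product form so that integral `β` needs no separate case. -/
lemma norm_sum_Ioc_e_mul_distInt_le (β : ℝ) (a b : ℕ) :
    ‖∑ n ∈ Finset.Ioc a b, e (β * n)‖ * distInt β ≤ 1 := by
  rcases le_total b a with h | h
  · simp [Finset.Ioc_eq_empty_of_le h]
  have h1 := congrArg norm (e_sub_one_mul_sum_Ioc β h)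
  rw [norm_mul] at h1
  have h2 : ‖e (β * (b + 1 : ℝ)) - e (β * (a + 1 : ℝ))‖ ≤ 2 := by
    refine (norm_sub_le _ _).trans ?_
    rw [norm_e, norm_e]; norm_num
  have h3 := four_mul_distInt_le_norm β
  have h4 := mul_le_mul_of_nonneg_right h3 (norm_nonneg (∑ n ∈ Finset.Ioc a b, e (β * n)))
  nlinarith

lemma norm_sum_Ioc_e_le (β : ℝ) (a b : ℕ) :
    ‖∑ n ∈ Finset.Ioc a b, e (β * n)‖ ≤ (b - a : ℕ) := by
  refine (norm_sum_le _ _).trans ?_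
  simp [norm_e]

/-! ### Spacing of `αh` modulo one and sums of reciprocal distances. -/

/-- Distinct multiples of a number with a good rational approximation of denominator `q`
are `1 / (2q)`-spaced modulo one over short ranges. -/
lemma inv_le_abs_mul_sub_int {α : ℝ} {a : ℤ} {q : ℕ} (hq : 0 < q) (hc : IsCoprime a (q : ℤ))
    (hα : |α - a / q| ≤ 1 / (q : ℝ) ^ 2) {h : ℤ} (h0 : h ≠ 0) (hh : |h| ≤ (q : ℤ) / 2) (n : ℤ) :
    1 / (2 * q : ℝ) ≤ |α * h - n| := by
  have hq' : (0 : ℝ) < q := by exact_mod_cast hq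
  -- Otherwise `q` divides `h`, impossible for `0 < |h| ≤ q / 2`. Hence `ah/q` is at least `1/q`
  -- from `n`, and replacing `a/q` by `α` costs at most half of that.
  have h1 : a * h - n * q ≠ 0 := by
    intro h2
    have h3 : (q : ℤ) ∣ a * h := ⟨n, by linarith⟩
    have h4 : (q : ℤ) ∣ h := hc.symm.dvd_of_dvd_mul_left h3
    have h5 := Int.le_of_dvd (abs_pos.mpr h0) ((dvd_abs _ _).mpr h4)
    omega
  have h2 : (1 : ℝ) ≤ |(a : ℝ) * h - n * q| := by
    have := Int.one_le_abs h1
    exact_mod_cast this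
  have h3 : 1 / (q : ℝ) ≤ |(a : ℝ) / q * h - n| := by
    rw [show (a : ℝ) / q * h - n = (a * h - n * q) / q by field_simp, abs_div, abs_of_pos hq']
    gcongr
  have h4 : |(h : ℝ)| ≤ q / 2 := by
    have h5 : 2 * |h| ≤ (q : ℤ) := by omega
    have h6 : 2 * |(h : ℝ)| ≤ q := by exact_mod_cast h5
    linarith
  have h5 : |(α - a / q) * h| ≤ 1 / (2 * q : ℝ) := by
    rw [abs_mul]
    calc |α - a / q| * |(h : ℝ)| ≤ 1 / (q : ℝ) ^ 2 * (q / 2) := by gcongr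
      _ = 1 / (2 * q : ℝ) := by field_simp
  have h6 : |(a : ℝ) / q * h - n| ≤ |α * h - n| + |(α - a / q) * h| := by
    rw [show (a : ℝ) / q * h - n = (α * h - n) - (α - a / q) * h by ring]
    exact abs_sub _ _
  have h7 : 1 / (q : ℝ) = 1 / (2 * q : ℝ) + 1 / (2 * q : ℝ) := by field_simp; norm_num
  linarith

lemma sum_range_le_add_log (M c : ℝ) (hc : 0 ≤ c) (n : ℕ) (hn : 0 < n) :
    ∑ j ∈ Finset.range n, (if j = 0 then M else c / (j : ℝ)) ≤ M + c * (1 + Real.log n) := by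
  obtain ⟨m, rfl⟩ : ∃ m, n = m + 1 := ⟨n - 1, by omega⟩
  rw [Finset.sum_range_succ']
  have h1 : ∑ k ∈ Finset.range m, (if k + 1 = 0 then M else c / ((k + 1 : ℕ) : ℝ))
      = c * (harmonic m : ℝ) := by
    rw [harmonic, Rat.cast_sum, Finset.mul_sum]
    refine Finset.sum_congr rfl fun k _ => ?_
    simp [div_eq_mul_inv]
  rw [h1]
  have h2 := harmonic_le_one_add_log m
  have h3 : Real.log m ≤ Real.log ((m + 1 : ℕ) : ℝ) := by
    rcases Nat.eq_zero_or_pos m with rfl | hm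
    · simp
    · exact Real.log_le_log (by exact_mod_cast hm) (by push_cast; linarith)
  have h4 : c * (harmonic m : ℝ) ≤ c * (1 + Real.log ((m + 1 : ℕ) : ℝ)) := by gcongr; linarith
  simp only [if_true]
  linarith

/-- The large values of `1 / ‖β + αh‖` in a short block of consecutive integers `h`. -/
lemma sum_block_le {α β : ℝ} {a : ℤ} {q : ℕ} (hq : 0 < q) (hc : IsCoprime a (q : ℤ))
    (hα : |α - a / q| ≤ 1 / (q : ℝ) ^ 2) {L : ℕ} (hL : L ≤ q / 2 + 1) {M : ℝ} (hM : 0 ≤ M)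
    (f : ℕ → ℝ) (hfM : ∀ h < L, f h ≤ M) (hf : ∀ h < L, f h * distInt (β + α * h) ≤ 1) :
    ∑ h ∈ Finset.range L, f h ≤ 2 * (M + 2 * q * (1 + Real.log (2 * q))) := by
  have hq' : (0 : ℝ) < q := by exact_mod_cast hq
  -- The unit interval is cut into `2q` cells of length `1/(2q)`; by the spacing, each cell receives
  -- at most one `h` of the block.
  set c : ℕ → ℕ := fun h => ⌊2 * q * Int.fract (β + α * h)⌋₊ with hcdef
  set g : ℕ → ℝ := fun j => if j = 0 then M else (2 * q : ℝ) / (j : ℝ) with hg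
  have hg0 : ∀ j, 0 ≤ g j := by
    intro j; simp only [hg]; split_ifs <;> positivity
  have hcl : ∀ h, c h < 2 * q := by
    intro h
    rw [hcdef]
    simp only
    rw [Nat.floor_lt (by have := Int.fract_nonneg (β + α * h); positivity)]
    have := Int.fract_lt_one (β + α * h)
    push_cast
    nlinarith
  have hinj : Set.InjOn c (Finset.range L) := by
    intro x hx y hy hxy
    by_contra hne
    simp only [Finset.coe_range, Set.mem_Iio] at hx hy
    have h1 := inv_le_abs_mul_sub_int hq hc hα (h := (x : ℤ) - y) (by omega)
      (by rw [abs_le]; constructor <;> omega) (⌊β + α * x⌋ - ⌊β + α * y⌋)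
    have hx1 := Nat.floor_le (a := 2 * q * Int.fract (β + α * x))
      (by have := Int.fract_nonneg (β + α * x); positivity)
    have hx2 := Nat.lt_floor_add_one (2 * q * Int.fract (β + α * x))
    have hy1 := Nat.floor_le (a := 2 * q * Int.fract (β + α * y))
      (by have := Int.fract_nonneg (β + α * y); positivity)
    have hy2 := Nat.lt_floor_add_one (2 * q * Int.fract (β + α * y))
    simp only [hcdef] at hxy
    rw [hxy] at hx1 hx2
    have h2 : α * ((x : ℤ) - y : ℤ) - (⌊β + α * x⌋ - ⌊β + α * y⌋ : ℤ)
        = Int.fract (β + α * x) - Int.fract (β + α * y) := by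
      simp only [Int.fract]
      push_cast
      ring
    rw [h2] at h1
    have h3 : |2 * q * Int.fract (β + α * x) - 2 * q * Int.fract (β + α * y)| < 1 := by
      rw [abs_lt]; constructor <;> linarith
    rw [← mul_sub, abs_mul, abs_of_pos (by positivity : (0 : ℝ) < 2 * q)] at h3
    have h4 : 2 * q * (1 / (2 * q : ℝ)) = 1 := by field_simp
    nlinarith [mul_le_mul_of_nonneg_left h1 (by positivity : (0 : ℝ) ≤ 2 * q)]
  -- The nearest integer may lie on either side of the point, so the cell index is counted from both
  -- ends; the two extreme cells receive the trivial bound `M`.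
  have hbound : ∀ h ∈ Finset.range L, f h ≤ g (c h) + g (2 * q - 1 - c h) := by
    intro h hh
    rw [Finset.mem_range] at hh
    have hcl' := hcl h
    have g1 := hg0 (c h)
    have g2 := hg0 (2 * q - 1 - c h)
    have ht0 := Int.fract_nonneg (β + α * h)
    have ht1 := Int.fract_lt_one (β + α * h)
    have hx1 := Nat.floor_le (a := 2 * q * Int.fract (β + α * h)) (by positivity)
    have hx2 := Nat.lt_floor_add_one (2 * q * Int.fract (β + α * h))
    by_cases hc0 : c h = 0
    · have : g (c h) = M := by simp [hg, hc0]
      linarith [hfM h hh]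
    by_cases hc1 : 2 * q - 1 - c h = 0
    · have : g (2 * q - 1 - c h) = M := by simp [hg, hc1]
      linarith [hfM h hh]
    by_cases hf0 : f h ≤ 0
    · linarith
    push Not at hf0
    have hfh := hf h hh
    have hd : distInt (β + α * h) = min (Int.fract (β + α * h)) (1 - Int.fract (β + α * h)) :=
      abs_sub_round_eq_min _
    rw [hd] at hfh
    rcases le_total (Int.fract (β + α * h)) (1 - Int.fract (β + α * h)) with hle | hle
    · rw [min_eq_left hle] at hfh
      have h1 : f h ≤ g (c h) := by
        simp only [hg, hc0, if_false]
        rw [le_div_iff₀ (by exact_mod_cast Nat.pos_of_ne_zero hc0)]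
        have : f h * (c h : ℝ) ≤ f h * (2 * q * Int.fract (β + α * h)) := by gcongr
        nlinarith
      linarith
    · rw [min_eq_right hle] at hfh
      have h1 : f h ≤ g (2 * q - 1 - c h) := by
        simp only [hg, hc1, if_false]
        rw [le_div_iff₀ (by exact_mod_cast Nat.pos_of_ne_zero hc1)]
        have h2 : ((2 * q - 1 - c h : ℕ) : ℝ) ≤ 2 * q * (1 - Int.fract (β + α * h)) := by
          rw [Nat.cast_sub (by omega), Nat.cast_sub (by omega)]
          push_cast
          simp only [hcdef]
          linarith
        have : f h * ((2 * q - 1 - c h : ℕ) : ℝ) ≤ f h * (2 * q * (1 - Int.fract (β + α * h))) := by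
          gcongr
        nlinarith
      linarith
  have hS : ∑ j ∈ Finset.range (2 * q), g j ≤ M + 2 * q * (1 + Real.log (2 * q)) := by
    have := sum_range_le_add_log M (2 * q) (by positivity) (2 * q) (by omega)
    push_cast at this
    exact this
  calc ∑ h ∈ Finset.range L, f h
      ≤ ∑ h ∈ Finset.range L, (g (c h) + g (2 * q - 1 - c h)) := Finset.sum_le_sum hbound
    _ = ∑ j ∈ (Finset.range L).image c, (g j + g (2 * q - 1 - j)) :=
        (Finset.sum_image (f := fun j => g j + g (2 * q - 1 - j)) hinj).symm
    _ ≤ ∑ j ∈ Finset.range (2 * q), (g j + g (2 * q - 1 - j)) := by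
        refine Finset.sum_le_sum_of_subset_of_nonneg ?_ fun j _ _ => add_nonneg (hg0 _) (hg0 _)
        intro j hj
        obtain ⟨h, -, rfl⟩ := Finset.mem_image.mp hj
        exact Finset.mem_range.mpr (hcl h)
    _ = 2 * ∑ j ∈ Finset.range (2 * q), g j := by
        rw [Finset.sum_add_distrib, Finset.sum_range_reflect g (2 * q)]
        ring
    _ ≤ _ := by linarith

lemma sum_range_mul_blocks (f : ℕ → ℝ) (k L : ℕ) :
    ∑ h ∈ Finset.range (k * L), f h
      = ∑ i ∈ Finset.range k, ∑ r ∈ Finset.range L, f (i * L + r) := by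
  induction k with
  | zero => simp
  | succ k ih => rw [Nat.succ_mul, Finset.sum_range_add, ih, Finset.sum_range_succ]

/-- `∑_{h < H} min(M, 1 / ‖β + αh‖) ≪ (H / q + 1)(M + q log q)`. -/
lemma sum_range_le_of_distInt {α β : ℝ} {a : ℤ} {q : ℕ} (hq : 0 < q)
    (hc : IsCoprime a (q : ℤ)) (hα : |α - a / q| ≤ 1 / (q : ℝ) ^ 2) {M : ℝ} (hM : 0 ≤ M)
    (H : ℕ) (f : ℕ → ℝ) (hfM : ∀ h < H, f h ≤ M)
    (hf : ∀ h < H, f h * distInt (β + α * h) ≤ 1) :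
    ∑ h ∈ Finset.range H, f h
      ≤ (2 * H / q + 1) * (2 * (M + 2 * q * (1 + Real.log (2 * q)))) := by
  have hq' : (0 : ℝ) < q := by exact_mod_cast hq
  set E := 2 * (M + 2 * q * (1 + Real.log (2 * q))) with hE
  have hlog : 0 ≤ Real.log (2 * q) := Real.log_nonneg (by
    have : (1 : ℝ) ≤ q := by exact_mod_cast hq
    linarith)
  have hE0 : 0 ≤ E := by positivity
  -- The longest block in which differences of indices stay at most `q / 2`.
  set L := q / 2 + 1 with hL
  set k := H / L + 1 with hk
  -- Truncation to a nonnegative function vanishing beyond `H` lets the range be completed to whole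
  -- blocks.
  set f' : ℕ → ℝ := fun h => if h < H then max (f h) 0 else 0 with hf'
  have hHk : H ≤ k * L := by
    have := Nat.lt_div_mul_add (a := H) (b := L) (by omega)
    rw [hk, add_mul]; omega
  have h1 : ∑ h ∈ Finset.range H, f h ≤ ∑ h ∈ Finset.range (k * L), f' h := by
    calc ∑ h ∈ Finset.range H, f h ≤ ∑ h ∈ Finset.range H, f' h := by
          refine Finset.sum_le_sum fun h hh => ?_
          simp [hf', Finset.mem_range.mp hh]
      _ ≤ _ := by
          refine Finset.sum_le_sum_of_subset_of_nonneg (Finset.range_mono hHk) fun h _ _ => ?_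
          simp only [hf']; split_ifs <;> simp
  have h2 : ∀ i ∈ Finset.range k, ∑ r ∈ Finset.range L, f' (i * L + r) ≤ E := by
    intro i _
    refine sum_block_le (β := β + α * ((i * L : ℕ) : ℝ)) hq hc hα le_rfl hM
      (fun r => f' (i * L + r)) ?_ ?_
    · intro r _
      simp only [hf']
      split_ifs with hr
      · exact max_le (hfM _ hr) hM
      · exact hM
    · intro r _
      simp only [hf']
      split_ifs with hr
      · rw [max_mul_of_nonneg _ _ (distInt_nonneg _), zero_mul]
        refine max_le ?_ zero_le_one
        have := hf _ hr
        rwa [show β + α * ((i * L : ℕ) : ℝ) + α * r = β + α * ((i * L + r : ℕ) : ℝ) by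
          push_cast; ring]
      · simp
  have h3 : (k : ℝ) ≤ 2 * H / q + 1 := by
    have h4 : ((H / L : ℕ) : ℝ) ≤ H / L := Nat.cast_div_le
    have h5 : (q : ℝ) / 2 ≤ L := by
      have : q ≤ 2 * L := by omega
      have : (q : ℝ) ≤ 2 * L := by exact_mod_cast this
      linarith
    have h6 : (H : ℝ) / L ≤ H / (q / 2) := by gcongr
    have h7 : (H : ℝ) / (q / 2) = 2 * H / q := by field_simp
    rw [hk]; push_cast; linarith
  rw [sum_range_mul_blocks] at h1
  calc ∑ h ∈ Finset.range H, f h ≤ _ := h1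
    _ ≤ ∑ i ∈ Finset.range k, E := Finset.sum_le_sum h2
    _ = k * E := by simp
    _ ≤ _ := by gcongr

/-! ### Type I sums. -/

/-- The exponential sum over the multiples of `d` up to `N`. -/
noncomputable def sumMultiples (N : ℕ) (α : ℝ) (d : ℕ) : ℂ :=
  ∑ n ∈ (Finset.Icc 1 N).filter (d ∣ ·), e (α * n)

lemma sum_filter_dvd_eq (N d : ℕ) (hd : 0 < d) (g : ℕ → ℂ) :
    ∑ n ∈ (Finset.Icc 1 N).filter (d ∣ ·), g n = ∑ m ∈ Finset.Ioc 0 (N / d), g (d * m) := by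
  symm
  refine Finset.sum_bij (fun m _ => d * m) ?_ ?_ ?_ (fun _ _ => rfl)
  · intro m hm
    rw [Finset.mem_Ioc] at hm
    rw [Finset.mem_filter, Finset.mem_Icc]
    refine ⟨⟨Nat.mul_pos hd hm.1, ?_⟩, dvd_mul_right _ _⟩
    exact (Nat.mul_le_mul_left d hm.2).trans (Nat.mul_div_le N d)
  · intro x _ y _ hxy
    exact Nat.eq_of_mul_eq_mul_left hd hxy
  · intro n hn
    rw [Finset.mem_filter, Finset.mem_Icc] at hn
    obtain ⟨⟨h1, h2⟩, m, rfl⟩ := hn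
    refine ⟨m, ?_, rfl⟩
    rw [Finset.mem_Ioc, Nat.le_div_iff_mul_le hd, mul_comm m d]
    exact ⟨Nat.pos_of_ne_zero (by rintro rfl; simp at h1), h2⟩

lemma sumMultiples_eq (N : ℕ) (α : ℝ) {d : ℕ} (hd : 0 < d) :
    sumMultiples N α d = ∑ m ∈ Finset.Ioc 0 (N / d), e (α * d * m) := by
  rw [sumMultiples, sum_filter_dvd_eq N d hd (fun n => e (α * n))]
  refine Finset.sum_congr rfl fun m _ => ?_
  push_cast
  rw [mul_assoc]

lemma norm_sumMultiples_le (N : ℕ) (α : ℝ) {d : ℕ} (hd : 0 < d) :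
    ‖sumMultiples N α d‖ ≤ N / d := by
  rw [sumMultiples_eq N α hd]
  refine (norm_sum_Ioc_e_le _ _ _).trans ?_
  rw [Nat.sub_zero]
  exact Nat.cast_div_le

lemma norm_sumMultiples_mul_distInt_le (N : ℕ) (α : ℝ) {d : ℕ} (hd : 0 < d) :
    ‖sumMultiples N α d‖ * distInt (α * d) ≤ 1 := by
  rw [sumMultiples_eq N α hd]
  exact norm_sum_Ioc_e_mul_distInt_le _ _ _

lemma sumMultiples_eq_zero {N : ℕ} (α : ℝ) {d : ℕ} (hd : N < d) : sumMultiples N α d = 0 := by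
  rw [sumMultiples_eq N α (by omega), Nat.div_eq_of_lt hd]
  simp

/-- Each term is at most `min(N/d, 1/‖αd‖)`. In blocks of length about `q/2` the trivial bound is
used only for the cells next to an integer, and over the blocks it decays harmonically, which yields
`N/q` up to a logarithm. -/
lemma sum_norm_sumMultiples_le {α : ℝ} {a : ℤ} {q : ℕ} (hq : 0 < q)
    (hc : IsCoprime a (q : ℤ)) (hα : |α - a / q| ≤ 1 / (q : ℝ) ^ 2) {N D : ℕ} (hN : 0 < N)
    (hqN : q ≤ N) (hD : D ≤ N) :
    ∑ d ∈ Finset.Icc 1 D, ‖sumMultiples N α d‖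
      ≤ 8 * (N / q + D + q) * (1 + Real.log (2 * N)) := by
  have hq' : (0 : ℝ) < q := by exact_mod_cast hq
  have hq1 : (1 : ℝ) ≤ q := by exact_mod_cast hq
  have hN1 : (1 : ℝ) ≤ N := by exact_mod_cast hN
  have hqN' : (q : ℝ) ≤ N := by exact_mod_cast hqN
  have hlogN : 0 ≤ Real.log (2 * N) := Real.log_nonneg (by linarith)
  have hlogq : Real.log (2 * q) ≤ Real.log (2 * N) :=
    Real.log_le_log (by positivity) (by linarith)
  have hlogq0 : 0 ≤ Real.log (2 * q) := Real.log_nonneg (by linarith)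
  set L := q / 2 + 1 with hL
  set k := D / L + 1 with hk
  have hLq : (q : ℝ) / 2 ≤ L := by
    have : q ≤ 2 * L := by omega
    have : (q : ℝ) ≤ 2 * L := by exact_mod_cast this
    linarith
  have hL0 : (0 : ℝ) < L := by positivity
  set f : ℕ → ℝ := fun d => if d = 0 then 0 else ‖sumMultiples N α d‖ with hf
  have hf0 : ∀ d, 0 ≤ f d := by intro d; simp only [hf]; split_ifs <;> positivity
  have hfd : ∀ d, f d * distInt (0 + α * d) ≤ 1 := by
    intro d
    simp only [hf, zero_add]
    split_ifs with h
    · simp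
    · exact norm_sumMultiples_mul_distInt_le N α (Nat.pos_of_ne_zero h)
  have hDk : D < k * L := by
    have := Nat.lt_div_mul_add (a := D) (b := L) (by omega)
    rw [hk, add_mul]; omega
  have h1 : ∑ d ∈ Finset.Icc 1 D, ‖sumMultiples N α d‖ ≤ ∑ d ∈ Finset.range (k * L), f d := by
    calc ∑ d ∈ Finset.Icc 1 D, ‖sumMultiples N α d‖ = ∑ d ∈ Finset.Icc 1 D, f d := by
          refine Finset.sum_congr rfl fun d hd => ?_
          rw [Finset.mem_Icc] at hd
          simp only [hf]
          rw [if_neg (by omega)]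
      _ ≤ _ := by
          refine Finset.sum_le_sum_of_subset_of_nonneg ?_ fun d _ _ => hf0 d
          intro d hd
          rw [Finset.mem_Icc] at hd
          exact Finset.mem_range.mpr (by omega)
  -- In block `0` the trivial bound `N/d` would be too large for small `d`, but there `αd` is at
  -- distance at least `1/(2q)` from the integers. In block `i ≥ 1` one has `d ≥ iL`.
  set M : ℕ → ℝ := fun i => if i = 0 then 2 * q else (N / L : ℝ) / (i : ℝ) with hM
  have h2 : ∀ i ∈ Finset.range k, ∑ r ∈ Finset.range L, f (i * L + r)
      ≤ 2 * (M i + 2 * q * (1 + Real.log (2 * q))) := by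
    intro i _
    refine sum_block_le (β := α * ((i * L : ℕ) : ℝ)) hq hc hα le_rfl
      (by simp only [hM]; split_ifs <;> positivity) (fun r => f (i * L + r)) ?_ ?_
    · intro r hr
      by_cases hi : i = 0
      · subst hi
        simp only [hM, if_true, zero_mul, zero_add]
        by_cases hr0 : r = 0
        · simp [hf, hr0]
        · have h3 := hfd r
          have h4 := inv_le_abs_mul_sub_int hq hc hα (h := r) (by omega)
            (by rw [abs_of_nonneg (by omega)]; omega) (round (α * r))
          rw [zero_add, distInt] at h3
          have h5 : f r * (1 / (2 * q)) ≤ 1 := by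
            refine le_trans ?_ h3
            refine mul_le_mul_of_nonneg_left ?_ (hf0 r)
            exact_mod_cast h4
          rw [mul_one_div, div_le_one (by positivity)] at h5
          exact h5
      · have hiL : 0 < i * L := Nat.mul_pos (Nat.pos_of_ne_zero hi) (by omega)
        have hir : i * L + r ≠ 0 := by omega
        simp only [hM, hf, hi, if_false, hir]
        refine (norm_sumMultiples_le N α (Nat.pos_of_ne_zero hir)).trans ?_
        rw [div_div]
        have h3 : (L : ℝ) * i ≤ ((i * L + r : ℕ) : ℝ) := by
          push_cast
          have : (0 : ℝ) ≤ r := Nat.cast_nonneg r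
          linarith [mul_comm (L : ℝ) i]
        have h4 : (0 : ℝ) < i := by exact_mod_cast Nat.pos_of_ne_zero hi
        gcongr
    · intro r _
      have := hfd (i * L + r)
      rwa [show α * ((i * L : ℕ) : ℝ) + α * r = 0 + α * ((i * L + r : ℕ) : ℝ) by
          push_cast; ring]
  have hkD : (k : ℝ) ≤ 2 * D / q + 1 := by
    have h4 : ((D / L : ℕ) : ℝ) ≤ D / L := Nat.cast_div_le
    have h6 : (D : ℝ) / L ≤ D / (q / 2) := by gcongr
    have h7 : (D : ℝ) / (q / 2) = 2 * D / q := by field_simp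
    rw [hk]; push_cast; linarith
  have hk2 : (k : ℝ) ≤ 2 * N := by
    have : D / L ≤ D := Nat.div_le_self _ _
    have : k ≤ 2 * N := by omega
    exact_mod_cast this
  have hk0 : (0 : ℝ) < k := by rw [hk]; positivity
  have hlogk : Real.log k ≤ Real.log (2 * N) := Real.log_le_log hk0 hk2
  have hMs : ∑ i ∈ Finset.range k, M i ≤ 2 * q + N / L * (1 + Real.log k) :=
    sum_range_le_add_log (2 * q) (N / L) (by positivity) k (Nat.succ_pos _)
  have hNL : (N : ℝ) / L ≤ 2 * (N / q) := by
    have h6 : (N : ℝ) / L ≤ N / (q / 2) := by gcongr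
    have h7 : (N : ℝ) / (q / 2) = 2 * (N / q) := by field_simp
    linarith
  have hlogk0 : 0 ≤ Real.log k := Real.log_nonneg (by exact_mod_cast (Nat.succ_pos (D / L) : 1 ≤ k))
  have h5 : (N : ℝ) / L * (1 + Real.log k) ≤ 2 * (N / q) * (1 + Real.log (2 * N)) := by gcongr
  have h6 : k * (2 * q * (1 + Real.log (2 * q)))
      ≤ (2 * D / q + 1) * (2 * q * (1 + Real.log (2 * N))) := by gcongr
  have h7 : (2 * D / q + 1) * (2 * q * (1 + Real.log (2 * N)))
      = (4 * D + 2 * q) * (1 + Real.log (2 * N)) := by field_simp; ring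
  rw [sum_range_mul_blocks] at h1
  have h8 : ∑ i ∈ Finset.range k, 2 * (M i + 2 * q * (1 + Real.log (2 * q)))
      = 2 * (∑ i ∈ Finset.range k, M i) + 2 * (k * (2 * q * (1 + Real.log (2 * q)))) := by
    rw [← Finset.mul_sum, Finset.sum_add_distrib]
    simp
    ring
  have h9 := h1.trans (Finset.sum_le_sum h2)
  rw [h8] at h9
  have h10 : (0 : ℝ) ≤ N / q := by positivity
  have h11 : 4 * (q : ℝ) ≤ 4 * q * (1 + Real.log (2 * N)) := by nlinarith
  nlinarith [mul_nonneg h10 hlogN]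

/-! ### Bilinear forms. -/

/-- Opening the square and summing over `a` first eliminates the unknown coefficients `y`, leaving
correlations of the kernel. -/
lemma sum_norm_sq_le_sum_sum_norm {ι κ : Type*} (s : Finset ι) (t : Finset κ) (y : κ → ℂ)
    (hy : ∀ m, ‖y m‖ ≤ 1) (c : ι → κ → ℂ) :
    ∑ a ∈ s, ‖∑ m ∈ t, y m * c a m‖ ^ 2
      ≤ ∑ m' ∈ t, ∑ m ∈ t, ‖∑ a ∈ s, c a m * (starRingEnd ℂ) (c a m')‖ := by
  have h1 : ((∑ a ∈ s, ‖∑ m ∈ t, y m * c a m‖ ^ 2 : ℝ) : ℂ)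
      = ∑ m' ∈ t, ∑ m ∈ t, y m * (starRingEnd ℂ) (y m') *
          ∑ a ∈ s, c a m * (starRingEnd ℂ) (c a m') := by
    push_cast
    simp_rw [← Complex.mul_conj', map_sum, map_mul, Finset.sum_mul_sum, Finset.mul_sum]
    rw [Finset.sum_comm]
    rw [Finset.sum_comm (s := t) (t := t)]
    refine Finset.sum_congr rfl fun m _ => ?_
    rw [Finset.sum_comm]
    refine Finset.sum_congr rfl fun m' _ => Finset.sum_congr rfl fun a _ => ?_
    ring
  have h2 : (∑ a ∈ s, ‖∑ m ∈ t, y m * c a m‖ ^ 2)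
      = ‖((∑ a ∈ s, ‖∑ m ∈ t, y m * c a m‖ ^ 2 : ℝ) : ℂ)‖ := by
    rw [Complex.norm_real, Real.norm_of_nonneg (by positivity)]
  rw [h2, h1]
  refine (norm_sum_le _ _).trans (Finset.sum_le_sum fun m' _ => ?_)
  refine (norm_sum_le _ _).trans (Finset.sum_le_sum fun m _ => ?_)
  rw [norm_mul, norm_mul, RCLike.norm_conj]
  have : ‖y m‖ * ‖y m'‖ ≤ 1 := mul_le_one₀ (hy m) (norm_nonneg _) (hy m')
  exact mul_le_of_le_one_left (norm_nonneg _) this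

lemma sum_Ioc_zero_eq_sum_range (g : ℕ → ℝ) (H : ℕ) :
    ∑ m ∈ Finset.Ioc 0 H, g m = ∑ r ∈ Finset.range H, g (r + 1) := by
  induction H with
  | zero => simp
  | succ H ih => rw [Finset.sum_Ioc_succ_top (by omega), Finset.sum_range_succ, ih]

/-- A bilinear form in the additive character over a dyadic range. -/
lemma norm_sq_bilinear_le {α : ℝ} {a : ℤ} {q : ℕ} (hq : 0 < q)
    (hc : IsCoprime a (q : ℤ)) (hα : |α - a / q| ≤ 1 / (q : ℝ) ^ 2) (N A : ℕ) (hA : 0 < A)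
    (x y : ℕ → ℂ) (hx : ∀ n, ‖x n‖ ≤ 1) (hy : ∀ n, ‖y n‖ ≤ 1) :
    ‖∑ b ∈ Finset.Ioc A (2 * A), x b * ∑ m ∈ Finset.Ioc 0 (N / b), y m * e (α * b * m)‖ ^ 2
      ≤ A * (((N / A : ℕ) : ℝ) * ((2 * ((N / A : ℕ) : ℝ) / q + 1) *
          (2 * (A + 2 * q * (1 + Real.log (2 * q)))))) := by
  set H := N / A with hH
  -- Moving the hyperbolic cutoff into the kernel makes the range of `m` independent of `b`.
  set c : ℕ → ℕ → ℂ := fun b m => if b * m ≤ N then e (α * b * m) else 0 with hcdef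
  have h1 : ∀ b ∈ Finset.Ioc A (2 * A), ∑ m ∈ Finset.Ioc 0 (N / b), y m * e (α * b * m)
      = ∑ m ∈ Finset.Ioc 0 H, y m * c b m := by
    intro b hb
    rw [Finset.mem_Ioc] at hb
    have hsub : Finset.Ioc 0 (N / b) ⊆ Finset.Ioc 0 H :=
      Finset.Ioc_subset_Ioc_right (Nat.div_le_div_left hb.1.le hA)
    rw [← Finset.sum_subset_zero_on_sdiff hsub (f := fun m => y m * e (α * b * m))]
    · intro m hm
      rw [Finset.mem_sdiff, Finset.mem_Ioc, Finset.mem_Ioc] at hm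
      have : ¬ (b * m ≤ N) := fun h =>
        hm.2 ⟨hm.1.1, (Nat.le_div_iff_mul_le (by omega)).mpr (by rwa [mul_comm])⟩
      simp [hcdef, this]
    · intro m hm
      rw [Finset.mem_Ioc, Nat.le_div_iff_mul_le (by omega), mul_comm] at hm
      simp [hcdef, hm.2]
  -- The two cutoffs confine `b` to an interval, so the correlation is a geometric sum of frequency
  -- `α(m - m')`.
  have hK : ∀ m m' : ℕ, 0 < m → 0 < m' →
      ∑ b ∈ Finset.Ioc A (2 * A), c b m * (starRingEnd ℂ) (c b m')
        = ∑ b ∈ Finset.Ioc A (min (2 * A) (min (N / m) (N / m'))),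
            e ((α * m - α * m') * b) := by
    intro m m' hm hm'
    have hsub : Finset.Ioc A (min (2 * A) (min (N / m) (N / m'))) ⊆ Finset.Ioc A (2 * A) :=
      Finset.Ioc_subset_Ioc_right (min_le_left _ _)
    symm
    refine Finset.sum_subset_zero_on_sdiff hsub ?_ ?_
    · intro b hb
      rw [Finset.mem_sdiff, Finset.mem_Ioc, Finset.mem_Ioc, le_min_iff, le_min_iff,
        Nat.le_div_iff_mul_le hm, Nat.le_div_iff_mul_le hm'] at hb
      by_cases h2 : b * m ≤ N
      · have h3 : ¬ (b * m' ≤ N) := fun h => hb.2 ⟨hb.1.1, hb.1.2, h2, h⟩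
        simp [hcdef, h3]
      · simp [hcdef, h2]
    · intro b hb
      rw [Finset.mem_Ioc, le_min_iff, le_min_iff,
        Nat.le_div_iff_mul_le hm, Nat.le_div_iff_mul_le hm'] at hb
      simp only [hcdef, hb.2.2.1, hb.2.2.2, if_true]
      rw [conj_e, ← e_add]
      congr 1
      ring
  have h2 : ∀ m' ∈ Finset.Ioc 0 H, ∑ m ∈ Finset.Ioc 0 H,
      ‖∑ b ∈ Finset.Ioc A (2 * A), c b m * (starRingEnd ℂ) (c b m')‖
        ≤ (2 * H / q + 1) * (2 * (A + 2 * q * (1 + Real.log (2 * q)))) := by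
    intro m' hm'
    rw [Finset.mem_Ioc] at hm'
    have h3 := sum_range_le_of_distInt (β := α - α * m') hq hc hα (M := A) (Nat.cast_nonneg _) H
      (fun r => ‖∑ b ∈ Finset.Ioc A (2 * A), c b (r + 1) * (starRingEnd ℂ) (c b m')‖)
      (by
        intro r _
        rw [hK _ _ (by omega) hm'.1]
        refine (norm_sum_Ioc_e_le _ _ _).trans ?_
        have : min (2 * A) (min (N / (r + 1)) (N / m')) - A ≤ A := by omega
        exact_mod_cast this)
      (by
        intro r _
        rw [hK _ _ (by omega) hm'.1]
        rw [show α - α * m' + α * r = α * ((r + 1 : ℕ) : ℝ) - α * m' by push_cast; ring]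
        exact norm_sum_Ioc_e_mul_distInt_le _ _ _)
    refine le_trans (le_of_eq ?_) h3
    exact sum_Ioc_zero_eq_sum_range _ H
  have h4 : ∑ b ∈ Finset.Ioc A (2 * A), ‖∑ m ∈ Finset.Ioc 0 H, y m * c b m‖ ^ 2
      ≤ H * ((2 * H / q + 1) * (2 * (A + 2 * q * (1 + Real.log (2 * q))))) := by
    refine (sum_norm_sq_le_sum_sum_norm _ _ y hy c).trans ?_
    refine (Finset.sum_le_sum h2).trans ?_
    simp
  calc ‖∑ b ∈ Finset.Ioc A (2 * A), x b * ∑ m ∈ Finset.Ioc 0 (N / b), y m * e (α * b * m)‖ ^ 2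
      ≤ (∑ b ∈ Finset.Ioc A (2 * A), ‖∑ m ∈ Finset.Ioc 0 H, y m * c b m‖) ^ 2 := by
        gcongr
        refine (norm_sum_le _ _).trans (Finset.sum_le_sum fun b hb => ?_)
        rw [norm_mul, h1 b hb]
        exact mul_le_of_le_one_left (norm_nonneg _) (hx b)
    _ ≤ ((Finset.Ioc A (2 * A)).card : ℝ) *
          ∑ b ∈ Finset.Ioc A (2 * A), ‖∑ m ∈ Finset.Ioc 0 H, y m * c b m‖ ^ 2 :=
        sq_sum_le_card_mul_sum_sq
    _ ≤ _ := by
        have : (Finset.Ioc A (2 * A)).card = A := by rw [Nat.card_Ioc]; omega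
        rw [this]
        gcongr

lemma sum_Ioc_two_pow_mul (g : ℕ → ℂ) (B K : ℕ) :
    ∑ b ∈ Finset.Ioc B (2 ^ K * B), g b
      = ∑ i ∈ Finset.range K, ∑ b ∈ Finset.Ioc (2 ^ i * B) (2 * (2 ^ i * B)), g b := by
  induction K with
  | zero => simp
  | succ K ih =>
    rw [Finset.sum_range_succ, ← ih, show 2 * (2 ^ K * B) = 2 ^ (K + 1) * B by ring]
    exact (Finset.sum_Ioc_consecutive g
      (Nat.le_mul_of_pos_left B (by positivity))
      (Nat.mul_le_mul_right B (Nat.pow_le_pow_right (by norm_num) (by omega)))).symm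

lemma natLog_two_add_one_le {N : ℕ} (hN : 0 < N) :
    ((Nat.log 2 N + 1 : ℕ) : ℝ) ≤ 2 * (1 + Real.log (2 * N)) := by
  have hN1 : (1 : ℝ) ≤ N := by exact_mod_cast hN
  have h1 := Real.natLog_le_logb N 2
  rw [Real.logb] at h1
  have h2 : Real.log N / Real.log (2 : ℕ) ≤ 2 * Real.log N := by
    have := Real.log_two_gt_d9
    rw [Nat.cast_ofNat, div_le_iff₀ (by linarith)]
    nlinarith [Real.log_nonneg hN1]
  have h3 : Real.log N ≤ Real.log (2 * N) := Real.log_le_log (by linarith) (by linarith)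
  push_cast
  linarith

/-- A bilinear form in the additive character on a minor arc. -/
lemma norm_bilinear_le {α : ℝ} {a : ℤ} {q : ℕ} (hq : 0 < q)
    (hc : IsCoprime a (q : ℤ)) (hα : |α - a / q| ≤ 1 / (q : ℝ) ^ 2) {N D B : ℕ} {Q : ℝ}
    (hN : 0 < N) (hQ : 1 ≤ Q) (hQq : Q ≤ q) (hqN : q ≤ N / Q) (hDN : D ≤ N / Q)
    (hB : Q / 2 ≤ B) (x y : ℕ → ℂ) (hx : ∀ n, ‖x n‖ ≤ 1) (hy : ∀ n, ‖y n‖ ≤ 1)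
    (hxD : ∀ n, D < n → x n = 0) :
    ‖∑ b ∈ Finset.Ioc B D, x b * ∑ m ∈ Finset.Ioc 0 (N / b), y m * e (α * b * m)‖
      ≤ 12 * (N / √Q) * (1 + Real.log (2 * N)) ^ 2 := by
  set ℓ := 1 + Real.log (2 * N) with hℓ
  have hN1 : (1 : ℝ) ≤ N := by exact_mod_cast hN
  have hQ0 : 0 < Q := by linarith
  have hNQ : (N : ℝ) / Q ≤ N := div_le_self (by linarith) hQ
  have hq1 : (1 : ℝ) ≤ q := by exact_mod_cast hq
  have hℓ1 : 1 ≤ ℓ := by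
    have := Real.log_nonneg (show (1 : ℝ) ≤ 2 * N by linarith)
    linarith
  have hlogq : 1 + Real.log (2 * q) ≤ ℓ := by
    have : Real.log (2 * q) ≤ Real.log (2 * N) :=
      Real.log_le_log (by positivity) (by linarith)
    linarith
  have hlogq0 : 0 ≤ Real.log (2 * q) := Real.log_nonneg (by linarith)
  have hB0 : 0 < B := by
    have : (0 : ℝ) < B := by linarith
    exact_mod_cast this
  set G : ℕ → ℂ := fun b => x b * ∑ m ∈ Finset.Ioc 0 (N / b), y m * e (α * b * m) with hG
  -- As `2^K > N ≥ D`, doubling `B` `K` times passes `D`; the excess is harmless because `x`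
  -- vanishes there.
  set K := Nat.log 2 N + 1 with hK
  have hDK : D ≤ 2 ^ K * B := by
    have h1 : (D : ℝ) ≤ N := hDN.trans hNQ
    have h2 : D ≤ N := by exact_mod_cast h1
    have h3 : N < 2 ^ K := Nat.lt_pow_succ_log_self (by norm_num) N
    nlinarith
  have h1 : ∑ b ∈ Finset.Ioc B D, G b = ∑ b ∈ Finset.Ioc B (2 ^ K * B), G b := by
    refine Finset.sum_subset (Finset.Ioc_subset_Ioc_right hDK) fun b hb hb' => ?_
    rw [Finset.mem_Ioc] at hb hb'
    simp [hG, hxD b (by omega)]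
  have h2 : ∀ i ∈ Finset.range K,
      ‖∑ b ∈ Finset.Ioc (2 ^ i * B) (2 * (2 ^ i * B)), G b‖ ≤ 6 * (N / √Q) * ℓ := by
    intro i _
    set A := 2 ^ i * B with hA
    have hA0 : 0 < A := by positivity
    have hBA : B ≤ A := Nat.le_mul_of_pos_left B (by positivity)
    rcases le_or_gt D A with hDA | hDA
    · rw [Finset.sum_eq_zero]
      · simp only [norm_zero]; positivity
      · intro b hb
        rw [Finset.mem_Ioc] at hb
        simp [hG, hxD b (by omega)]
    have h3 := norm_sq_bilinear_le hq hc hα N A hA0 x y hx hy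
    have hAR : (0 : ℝ) < A := by exact_mod_cast hA0
    have hAQ : Q / 2 ≤ A := hB.trans (by exact_mod_cast hBA)
    have hAD : (A : ℝ) ≤ N / Q := le_trans (by exact_mod_cast hDA.le) hDN
    have hH : ((N / A : ℕ) : ℝ) ≤ N / A := Nat.cast_div_le
    have h4 : (A : ℝ) * (((N / A : ℕ) : ℝ) * ((2 * ((N / A : ℕ) : ℝ) / q + 1) *
          (2 * (A + 2 * q * (1 + Real.log (2 * q))))))
        ≤ A * ((N / A) * ((2 * (N / A) / q + 1) * (2 * (A + 2 * q * ℓ)))) := by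
      gcongr
    have h5 : A * ((N / A) * ((2 * (N / A) / q + 1) * (2 * (A + 2 * q * ℓ))))
        = N * (4 * (N / q) + 8 * (N / A) * ℓ + 2 * A + 4 * q * ℓ) := by
      field_simp
      ring
    have h6 : (N : ℝ) / q ≤ N / Q := by gcongr
    have h7 : (N : ℝ) / A ≤ 2 * (N / Q) := by
      calc (N : ℝ) / A ≤ N / (Q / 2) := by gcongr
        _ = 2 * (N / Q) := by field_simp
    have hT0 : 0 ≤ (N : ℝ) / Q := by positivity
    -- Each of `N/q`, `N/A`, `A`, `q` is at most `N/Q`, up to a factor `2` for `N/A`; `26 = 4 + 16 +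
    -- 2 + 4` is then rounded up to `6²`.
    have h8 : 4 * (N / q) + 8 * (N / A) * ℓ + 2 * A + 4 * q * ℓ ≤ 26 * (N / Q) * ℓ := by
      have e1 : (N : ℝ) / A * ℓ ≤ 2 * (N / Q) * ℓ := by gcongr
      have e2 : q * ℓ ≤ N / Q * ℓ := by gcongr
      have e3 : (N : ℝ) / Q ≤ N / Q * ℓ := le_mul_of_one_le_right hT0 hℓ1
      linarith
    have h9 : ‖∑ b ∈ Finset.Ioc A (2 * A), G b‖ ^ 2 ≤ (6 * (N / √Q) * ℓ) ^ 2 := by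
      refine (h3.trans h4).trans ?_
      rw [h5]
      calc (N : ℝ) * (4 * (N / q) + 8 * (N / A) * ℓ + 2 * A + 4 * q * ℓ)
          ≤ N * (26 * (N / Q) * ℓ) := by gcongr
        _ = 26 * (N * (N / Q)) * ℓ := by ring
        _ ≤ 36 * (N * (N / Q)) * ℓ ^ 2 := by
            gcongr
            · norm_num
            · nlinarith
        _ = (6 * (N / √Q) * ℓ) ^ 2 := by
            rw [mul_pow, mul_pow, div_pow, Real.sq_sqrt hQ0.le]
            ring
    exact le_of_sq_le_sq h9 (by positivity)
  have h3 : ‖∑ b ∈ Finset.Ioc B D, G b‖ ≤ K * (6 * (N / √Q) * ℓ) := by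
    rw [h1, sum_Ioc_two_pow_mul]
    refine (norm_sum_le _ _).trans ((Finset.sum_le_sum h2).trans ?_)
    simp
  have h4 : (K : ℝ) ≤ 2 * ℓ := natLog_two_add_one_le hN
  calc ‖∑ b ∈ Finset.Ioc B D, G b‖ ≤ K * (6 * (N / √Q) * ℓ) := h3
    _ ≤ 2 * ℓ * (6 * (N / √Q) * ℓ) := by gcongr
    _ = 12 * (N / √Q) * ℓ ^ 2 := by ring

/-! ### Rankin's bound for smooth numbers. -/

lemma inv_one_sub_le_exp {x : ℝ} (h0 : 0 ≤ x) (h1 : x ≤ 3 / 4) : (1 - x)⁻¹ ≤ Real.exp (4 * x) := by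
  rw [inv_le_comm₀ (by linarith) (Real.exp_pos _)]
  have h2 := Real.add_one_le_exp (4 * x)
  calc (Real.exp (4 * x))⁻¹ ≤ (4 * x + 1)⁻¹ := by gcongr
    _ ≤ 1 - x := by
      rw [inv_le_iff_one_le_mul₀ (by linarith)]
      nlinarith

/-- The completely multiplicative function `n ↦ n ^ (-σ)`. -/
noncomputable def rpowNegHom (σ : ℝ) : ℕ →* ℝ where
  toFun n := (n : ℝ) ^ (-σ)
  map_one' := by simp
  map_mul' m n := by
    push_cast
    exact Real.mul_rpow (Nat.cast_nonneg _) (Nat.cast_nonneg _)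

/-- Rankin's bound for the number of smooth numbers. -/
lemma card_smoothNumbers_le (N k : ℕ) (hN : 0 < N) (hk : 2 ≤ Real.log k) :
    (((Finset.Icc 1 N).filter (· ∈ Nat.smoothNumbers k)).card : ℝ)
      ≤ N * Real.exp (-(Real.log N / Real.log k)) * Real.exp (12 * (1 + Real.log k)) := by
  have hNR : (0 : ℝ) < N := by exact_mod_cast hN
  -- Rankin's exponent: `p^(1 / log k) ≤ e < 3` for `p < k`, so each Euler factor is at most `exp(4
  -- · 3/p)`, while `σ ≥ 1/2` keeps `p^(-σ)` below `3/4`.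
  set σ : ℝ := 1 - 1 / Real.log k with hσ
  have hlk : 1 / Real.log k ≤ 1 / 2 := by gcongr
  have hlk0 : 0 < 1 / Real.log k := by positivity
  have hσ2 : 1 / 2 ≤ σ := by linarith
  have hp34 : ∀ p : ℕ, p.Prime → (p : ℝ) ^ (-σ) ≤ 3 / 4 := by
    intro p hp
    have hp2 : (2 : ℝ) ≤ p := by exact_mod_cast hp.two_le
    calc (p : ℝ) ^ (-σ) ≤ (p : ℝ) ^ (-(1 / 2) : ℝ) :=
          Real.rpow_le_rpow_of_exponent_le (by linarith) (by linarith)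
      _ ≤ (2 : ℝ) ^ (-(1 / 2) : ℝ) :=
          Real.rpow_le_rpow_of_nonpos (by norm_num) hp2 (by norm_num)
      _ ≤ 3 / 4 := by
          rw [Real.rpow_neg (by norm_num), ← Real.sqrt_eq_rpow,
            inv_le_comm₀ (by positivity) (by norm_num)]
          exact Real.le_sqrt_of_sq_le (by norm_num)
  have hnn : ∀ n : ℕ, 0 ≤ (n : ℝ) ^ (-σ) := fun n => Real.rpow_nonneg (Nat.cast_nonneg _) _
  obtain ⟨-, hsum⟩ := EulerProduct.summable_and_hasSum_smoothNumbers_prod_primesBelow_geometric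
    (f := rpowNegHom σ) (by
      intro p hp
      change ‖(p : ℝ) ^ (-σ)‖ < 1
      rw [Real.norm_of_nonneg (hnn p)]
      linarith [hp34 p hp]) k
  have h1 : ∑ n ∈ (Finset.Icc 1 N).filter (· ∈ Nat.smoothNumbers k), (n : ℝ) ^ (-σ)
      ≤ ∏ p ∈ Nat.primesBelow k, (1 - (p : ℝ) ^ (-σ))⁻¹ := by
    have h2 := (hasSum_subtype_iff_indicator (f := fun n : ℕ => (n : ℝ) ^ (-σ))).mp hsum
    have h3 := sum_le_hasSum (Finset.Icc 1 N)
      (fun n _ => Set.indicator_nonneg (fun n _ => hnn n) n) h2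
    rw [Finset.sum_filter]
    refine le_trans (le_of_eq ?_) h3
    exact Finset.sum_congr rfl fun n _ => by by_cases h : n ∈ Nat.smoothNumbers k <;> simp [h]
  have h2 : ∏ p ∈ Nat.primesBelow k, (1 - (p : ℝ) ^ (-σ))⁻¹
      ≤ Real.exp (12 * (1 + Real.log k)) := by
    calc ∏ p ∈ Nat.primesBelow k, (1 - (p : ℝ) ^ (-σ))⁻¹
        ≤ ∏ p ∈ Nat.primesBelow k, Real.exp (12 * (p : ℝ)⁻¹) := by
          refine Finset.prod_le_prod (fun p hp => ?_) (fun p hp => ?_)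
          · have := hp34 p (Nat.prime_of_mem_primesBelow hp)
            rw [inv_nonneg]; linarith
          · have hpp := Nat.prime_of_mem_primesBelow hp
            have hpk := Nat.lt_of_mem_primesBelow hp
            have hp0 : (0 : ℝ) < p := by exact_mod_cast hpp.pos
            refine (inv_one_sub_le_exp (hnn p) (hp34 p hpp)).trans ?_
            rw [Real.exp_le_exp]
            have h3 : (p : ℝ) ^ (-σ) = (p : ℝ)⁻¹ * Real.exp (Real.log p * (1 / Real.log k)) := by
              rw [← Real.rpow_def_of_pos hp0, ← Real.rpow_neg_one, ← Real.rpow_add hp0]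
              congr 1
              rw [hσ]; ring
            have h4 : Real.log p * (1 / Real.log k) ≤ 1 := by
              rw [mul_one_div, div_le_one (by linarith)]
              exact Real.log_le_log hp0 (by exact_mod_cast hpk.le)
            have h5 : Real.exp (Real.log p * (1 / Real.log k)) ≤ 3 :=
              (Real.exp_le_exp.mpr h4).trans (by linarith [Real.exp_one_lt_d9])
            rw [h3]
            have : (p : ℝ)⁻¹ * Real.exp (Real.log p * (1 / Real.log k)) ≤ (p : ℝ)⁻¹ * 3 := by gcongr
            linarith
      _ = Real.exp (12 * ∑ p ∈ Nat.primesBelow k, (p : ℝ)⁻¹) := by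
          rw [← Real.exp_sum, Finset.mul_sum]
      _ ≤ _ := by
          rw [Real.exp_le_exp]
          -- The harmonic sum replaces Mertens' theorem. The loss is a fixed power of `k`, which
          -- `exp(-log N / log k)` absorbs when `k` is about a power of `log N`.
          have h3 : ∑ p ∈ Nat.primesBelow k, (p : ℝ)⁻¹ ≤ ∑ n ∈ Finset.Icc 1 k, (n : ℝ)⁻¹ := by
            refine Finset.sum_le_sum_of_subset_of_nonneg (fun p hp => ?_)
              fun n _ _ => by positivity
            rw [Finset.mem_Icc]
            exact ⟨(Nat.prime_of_mem_primesBelow hp).one_le, (Nat.lt_of_mem_primesBelow hp).le⟩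
          have h4 := harmonic_le_one_add_log k
          rw [harmonic_eq_sum_Icc] at h4
          push_cast at h4
          linarith
  have h3 : (N : ℝ) ^ σ = N * Real.exp (-(Real.log N / Real.log k)) := by
    rw [hσ, Real.rpow_sub hNR, Real.rpow_one, Real.rpow_def_of_pos hNR, mul_one_div,
      Real.exp_neg, div_eq_mul_inv]
  rw [← h3]
  calc (((Finset.Icc 1 N).filter (· ∈ Nat.smoothNumbers k)).card : ℝ)
      = ∑ n ∈ (Finset.Icc 1 N).filter (· ∈ Nat.smoothNumbers k), (1 : ℝ) := by simp
    _ ≤ ∑ n ∈ (Finset.Icc 1 N).filter (· ∈ Nat.smoothNumbers k),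
          (N : ℝ) ^ σ * (n : ℝ) ^ (-σ) := by
        refine Finset.sum_le_sum fun n hn => ?_
        rw [Finset.mem_filter, Finset.mem_Icc] at hn
        have hn0 : (0 : ℝ) < n := by exact_mod_cast hn.1.1
        rw [Real.rpow_neg hn0.le, ← div_eq_mul_inv, one_le_div (by positivity)]
        exact Real.rpow_le_rpow hn0.le (by exact_mod_cast hn.1.2) (by linarith)
    _ = (N : ℝ) ^ σ * ∑ n ∈ (Finset.Icc 1 N).filter (· ∈ Nat.smoothNumbers k),
          (n : ℝ) ^ (-σ) := by rw [Finset.mul_sum]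
    _ ≤ (N : ℝ) ^ σ * Real.exp (12 * (1 + Real.log k)) := by
        gcongr
        exact h1.trans h2

/-! ### Ramaré's weights and the exponential sum over smooth numbers. -/

/-- The number of prime factors of `n` in the set `s`, counted with multiplicity. -/
def cardFactorsIn (s : Finset ℕ) (n : ℕ) : ℕ := ∑ p ∈ s, n.factorization p

/-- The primes in `(B, D]`. -/
def primesIoc (B D : ℕ) : Finset ℕ := (Finset.Ioc B D).filter Nat.Prime

lemma mem_primesIoc {B D p : ℕ} : p ∈ primesIoc B D ↔ (B < p ∧ p ≤ D) ∧ p.Prime := by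
  simp [primesIoc]

/-- Counting with multiplicity makes this hold even when `p ∣ m`, so Ramaré's denominator at `n =
pm` depends on `m` alone. -/
lemma cardFactorsIn_mul {s : Finset ℕ} {p m : ℕ} (hp : p.Prime) (hps : p ∈ s) (hm : m ≠ 0) :
    cardFactorsIn s (p * m) = cardFactorsIn s m + 1 := by
  unfold cardFactorsIn
  rw [Nat.factorization_mul hp.ne_zero hm, hp.factorization]
  simp only [Finsupp.add_apply, Finset.sum_add_distrib]
  have h : ∑ x ∈ s, (Finsupp.single p 1) x = 1 := by
    rw [Finset.sum_eq_single_of_mem p hps]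
    · simp
    · intro r _ hr
      simp [hr.symm]
  rw [h, add_comm]

/-- Ramaré's weights detect the integers with a prime factor in `(B, D]`, up to the
integers divisible by the square of such a prime. -/
lemma abs_one_sub_div_le {B D n : ℕ} (hn : n ∈ Nat.smoothNumbers (D + 1)) :
    |1 - (((primesIoc B D).filter (· ∣ n)).card : ℝ) / cardFactorsIn (primesIoc B D) n|
      ≤ (if n ∈ Nat.smoothNumbers (B + 1) then 1 else 0)
        + (((primesIoc B D).filter (fun p => p ^ 2 ∣ n)).card : ℝ) := by
  have hn0 : n ≠ 0 := Nat.ne_zero_of_mem_smoothNumbers hn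
  have hcard : ((primesIoc B D).filter (· ∣ n)).card
      = ∑ p ∈ primesIoc B D, if p ∣ n then 1 else 0 := Finset.card_filter _ _
  have hterm : ∀ p ∈ primesIoc B D, (if p ∣ n then 1 else 0) ≤ n.factorization p := by
    intro p hp
    split_ifs with h
    · exact (mem_primesIoc.mp hp).2.factorization_pos_of_dvd hn0 h
    · exact Nat.zero_le _
  have hle : ((primesIoc B D).filter (· ∣ n)).card ≤ cardFactorsIn (primesIoc B D) n := by
    rw [hcard]; exact Finset.sum_le_sum hterm
  have hrange : |1 - (((primesIoc B D).filter (· ∣ n)).card : ℝ)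
      / cardFactorsIn (primesIoc B D) n| ≤ 1 := by
    have h1 : (((primesIoc B D).filter (· ∣ n)).card : ℝ)
      / cardFactorsIn (primesIoc B D) n ≤ 1 :=
      div_le_one_of_le₀ (by exact_mod_cast hle) (Nat.cast_nonneg _)
    have h2 : 0 ≤ (((primesIoc B D).filter (· ∣ n)).card : ℝ)
      / cardFactorsIn (primesIoc B D) n := by positivity
    rw [abs_le]; constructor <;> linarith
  -- Here the quotient is `0 / 0 = 0` and the weight misses `n` entirely, but `n` then has all its
  -- prime factors at most `B`.
  by_cases hw : cardFactorsIn (primesIoc B D) n = 0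
  · have hB : n ∈ Nat.smoothNumbers (B + 1) := by
      rw [Nat.mem_smoothNumbers']
      intro p hp hpn
      by_contra hlt
      have hpD := Nat.mem_smoothNumbers'.mp hn p hp hpn
      have hpP : p ∈ primesIoc B D := mem_primesIoc.mpr ⟨⟨by omega, by omega⟩, hp⟩
      have h1 := (Finset.sum_eq_zero_iff.mp hw) p hpP
      have h2 := hp.factorization_pos_of_dvd hn0 hpn
      omega
    rw [if_pos hB]
    have : (0 : ℝ) ≤ (((primesIoc B D).filter (fun p => p ^ 2 ∣ n)).card : ℝ) := by positivity
    linarith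
  · have hif : (0 : ℝ) ≤ if n ∈ Nat.smoothNumbers (B + 1) then 1 else 0 := by
      split_ifs <;> norm_num
    by_cases hsq : ((primesIoc B D).filter (fun p => p ^ 2 ∣ n)).card = 0
    · have heq : ((primesIoc B D).filter (· ∣ n)).card = cardFactorsIn (primesIoc B D) n := by
        rw [hcard]
        refine Finset.sum_congr rfl fun p hp => le_antisymm (hterm p hp) ?_
        have hpp := (mem_primesIoc.mp hp).2
        have h1 : ¬ p ^ 2 ∣ n := by
          have := Finset.filter_eq_empty_iff.mp (Finset.card_eq_zero.mp hsq)
          exact this hp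
        rw [hpp.pow_dvd_iff_le_factorization hn0] at h1
        split_ifs with h
        · omega
        · rw [Nat.factorization_eq_zero_of_not_dvd h]
      rw [heq, div_self (by exact_mod_cast hw)]
      simp only [sub_self, abs_zero]
      positivity
    · have : (1 : ℝ) ≤ (((primesIoc B D).filter (fun p => p ^ 2 ∣ n)).card : ℝ) := by
        exact_mod_cast Nat.one_le_iff_ne_zero.mpr hsq
      linarith

lemma sum_card_sq_dvd_le (B D N : ℕ) :
    ∑ n ∈ Finset.Icc 1 N, (((primesIoc B D).filter (fun p => p ^ 2 ∣ n)).card : ℝ)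
      ≤ N * (2 / (B + 1)) := by
  have h1 : ∑ n ∈ Finset.Icc 1 N, (((primesIoc B D).filter (fun p => p ^ 2 ∣ n)).card : ℝ)
      = ∑ p ∈ primesIoc B D, (((Finset.Icc 1 N).filter (p ^ 2 ∣ ·)).card : ℝ) := by
    simp_rw [Finset.card_filter]
    push_cast
    exact Finset.sum_comm
  rw [h1]
  calc ∑ p ∈ primesIoc B D, (((Finset.Icc 1 N).filter (p ^ 2 ∣ ·)).card : ℝ)
      ≤ ∑ p ∈ primesIoc B D, N * ((p : ℝ) ^ 2)⁻¹ := by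
        refine Finset.sum_le_sum fun p _ => ?_
        have h2 : ((Finset.Icc 1 N).filter (p ^ 2 ∣ ·)).card = N / p ^ 2 := by
          rw [← Nat.Ioc_filter_dvd_card_eq_div]
          rfl
        rw [h2, ← div_eq_mul_inv]
        have : ((N / p ^ 2 : ℕ) : ℝ) ≤ (N : ℝ) / ((p ^ 2 : ℕ) : ℝ) := Nat.cast_div_le
        simpa using this
    _ = N * ∑ p ∈ primesIoc B D, ((p : ℝ) ^ 2)⁻¹ := by rw [Finset.mul_sum]
    _ ≤ N * ∑ p ∈ Finset.Ioo B (D + 1), ((p : ℝ) ^ 2)⁻¹ := by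
        gcongr
        intro p hp
        have := (mem_primesIoc.mp hp).1
        rw [Finset.mem_Ioo]; omega
    _ ≤ _ := by
        gcongr
        exact sum_Ioo_inv_sq_le B (D + 1)

/-- Writing `n = pm` separates the variables: both the denominator and the smoothness condition
involve only `m`. -/
lemma sum_ramare_weights (B D N : ℕ) (α : ℝ) :
    ∑ n ∈ (Finset.Icc 1 N).filter (· ∈ Nat.smoothNumbers (D + 1)),
        ((((primesIoc B D).filter (· ∣ n)).card : ℂ) / cardFactorsIn (primesIoc B D) n)
          * e (α * n)
      = ∑ b ∈ Finset.Ioc B D, (if b.Prime then 1 else 0) * ∑ m ∈ Finset.Ioc 0 (N / b),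
          (if m ∈ Nat.smoothNumbers (D + 1) then
            ((cardFactorsIn (primesIoc B D) m + 1 : ℕ) : ℂ)⁻¹ else 0) * e (α * b * m) := by
  set P := primesIoc B D with hP
  have h1 : ∀ n, (((P.filter (· ∣ n)).card : ℂ) / cardFactorsIn P n) * e (α * n)
      = ∑ p ∈ P, if p ∣ n then (cardFactorsIn P n : ℂ)⁻¹ * e (α * n) else 0 := by
    intro n
    rw [← Finset.sum_filter, Finset.sum_const, nsmul_eq_mul]
    ring
  simp_rw [h1]
  rw [Finset.sum_comm]
  simp_rw [ite_mul, one_mul, zero_mul]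
  rw [← Finset.sum_filter]
  change ∑ p ∈ P, _ = ∑ p ∈ P, _
  refine Finset.sum_congr rfl fun p hp => ?_
  obtain ⟨⟨hp1, hp2⟩, hpp⟩ := mem_primesIoc.mp hp
  rw [Finset.sum_filter]
  have h2 : ∀ n, (if n ∈ Nat.smoothNumbers (D + 1) then
        (if p ∣ n then (cardFactorsIn P n : ℂ)⁻¹ * e (α * n) else 0) else 0)
      = if p ∣ n then (if n ∈ Nat.smoothNumbers (D + 1) then
          (cardFactorsIn P n : ℂ)⁻¹ * e (α * n) else 0) else 0 := by
    intro n; split_ifs <;> rfl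
  simp_rw [h2]
  rw [← Finset.sum_filter, sum_filter_dvd_eq N p hpp.pos]
  refine Finset.sum_congr rfl fun m hm => ?_
  have hm0 : m ≠ 0 := by rw [Finset.mem_Ioc] at hm; omega
  have hsm : p * m ∈ Nat.smoothNumbers (D + 1) ↔ m ∈ Nat.smoothNumbers (D + 1) := by
    constructor
    · intro h; exact Nat.mem_smoothNumbers_of_dvd h (dvd_mul_left m p)
    · intro h
      exact Nat.mul_mem_smoothNumbers (Nat.mem_smoothNumbers_of_lt hpp.pos (by omega)) h
  rw [cardFactorsIn_mul hpp hp hm0]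
  simp only [hsm]
  split_ifs
  · push_cast
    rw [mul_assoc α]
  · rfl

/-- The exponential sum over smooth numbers on a minor arc. -/
lemma norm_sum_smooth_le {α : ℝ} {a : ℤ} {q : ℕ} (hq : 0 < q)
    (hc : IsCoprime a (q : ℤ)) (hα : |α - a / q| ≤ 1 / (q : ℝ) ^ 2) {N D B : ℕ} {Q : ℝ}
    (hN : 0 < N) (hQ : 1 ≤ Q) (hQq : Q ≤ q) (hqN : q ≤ N / Q) (hDN : D ≤ N / Q)
    (hB : Q / 2 ≤ B) :
    ‖∑ n ∈ (Finset.Icc 1 N).filter (· ∈ Nat.smoothNumbers (D + 1)), e (α * n)‖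
      ≤ ((Finset.Icc 1 N).filter (· ∈ Nat.smoothNumbers (B + 1))).card + 4 * (N / Q)
        + 12 * (N / √Q) * (1 + Real.log (2 * N)) ^ 2 := by
  set S := (Finset.Icc 1 N).filter (· ∈ Nat.smoothNumbers (D + 1)) with hS
  set P := primesIoc B D with hP
  set ρ : ℕ → ℝ := fun n => ((P.filter (· ∣ n)).card : ℝ) / cardFactorsIn P n with hρ
  have h1 : ∑ n ∈ S, e (α * n) = ∑ n ∈ S, ((1 - ρ n : ℝ) : ℂ) * e (α * n)
      + ∑ n ∈ S, (((P.filter (· ∣ n)).card : ℂ) / cardFactorsIn P n) * e (α * n) := by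
    rw [← Finset.sum_add_distrib]
    refine Finset.sum_congr rfl fun n _ => ?_
    simp only [hρ]
    push_cast
    ring
  have h2 : ‖∑ n ∈ S, ((1 - ρ n : ℝ) : ℂ) * e (α * n)‖
      ≤ ((Finset.Icc 1 N).filter (· ∈ Nat.smoothNumbers (B + 1))).card + 4 * (N / Q) := by
    have hQ0 : 0 < Q := by linarith
    calc ‖∑ n ∈ S, ((1 - ρ n : ℝ) : ℂ) * e (α * n)‖
        ≤ ∑ n ∈ S, ((if n ∈ Nat.smoothNumbers (B + 1) then 1 else 0)
            + ((P.filter (fun p => p ^ 2 ∣ n)).card : ℝ)) := by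
          refine (norm_sum_le _ _).trans (Finset.sum_le_sum fun n hn => ?_)
          rw [norm_mul, norm_e, mul_one, Complex.norm_real, Real.norm_eq_abs]
          exact abs_one_sub_div_le (Finset.mem_filter.mp hn).2
      _ ≤ ∑ n ∈ Finset.Icc 1 N, ((if n ∈ Nat.smoothNumbers (B + 1) then 1 else 0)
            + ((P.filter (fun p => p ^ 2 ∣ n)).card : ℝ)) := by
          refine Finset.sum_le_sum_of_subset_of_nonneg (Finset.filter_subset _ _) fun n _ _ => ?_
          split_ifs <;> positivity
      _ = ((Finset.Icc 1 N).filter (· ∈ Nat.smoothNumbers (B + 1))).card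
            + ∑ n ∈ Finset.Icc 1 N, ((P.filter (fun p => p ^ 2 ∣ n)).card : ℝ) := by
          rw [Finset.sum_add_distrib, Finset.sum_boole]
      _ ≤ _ := by
          gcongr
          refine (sum_card_sq_dvd_le B D N).trans ?_
          calc (N : ℝ) * (2 / (B + 1)) ≤ N * (2 / (Q / 2)) := by gcongr; linarith
            _ = 4 * (N / Q) := by field_simp; norm_num
  rw [h1]
  refine (norm_add_le _ _).trans (add_le_add h2 ?_)
  rw [sum_ramare_weights]
  -- The condition `b ≤ D` makes the coefficient vanish beyond `D`, as `norm_bilinear_le` requires.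
  have h3 : ∀ b ∈ Finset.Ioc B D, (if b.Prime then (1 : ℂ) else 0)
      = if b.Prime ∧ b ≤ D then 1 else 0 := by
    intro b hb
    rw [Finset.mem_Ioc] at hb
    simp [hb.2]
  rw [Finset.sum_congr rfl fun b hb => by rw [h3 b hb]]
  refine norm_bilinear_le hq hc hα hN hQ hQq hqN hDN hB _ _ ?_ ?_ ?_
  · intro b
    split_ifs <;> simp
  · intro m
    split_ifs
    · rw [norm_inv, Complex.norm_natCast]
      exact inv_le_one_of_one_le₀ (by push_cast; linarith [Nat.cast_nonneg (α := ℝ) (cardFactorsIn P m)])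
    · simp
  · intro b hb
    rw [if_neg (by omega)]

/-! ### Decomposition of `F` over prime powers and the pointwise bound. -/

lemma factorization_eq_sum_pow_dvd {p n K : ℕ} (hp : p.Prime) (hn : n ≠ 0) (hK : n < 2 ^ K) :
    n.factorization p = ∑ k ∈ Finset.Icc 1 K, if p ^ k ∣ n then 1 else 0 := by
  have h1 : n.factorization p ≤ K := by
    have h2 : 2 ^ n.factorization p ≤ n :=
      (Nat.pow_le_pow_left hp.two_le _).trans
        (Nat.le_of_dvd (Nat.pos_of_ne_zero hn) (Nat.ordProj_dvd n p))
    exact ((Nat.pow_lt_pow_iff_right (by norm_num)).mp (h2.trans_lt hK)).le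
  rw [← Finset.card_filter]
  have h3 : (Finset.Icc 1 K).filter (fun k => p ^ k ∣ n) = Finset.Icc 1 (n.factorization p) := by
    ext k
    rw [Finset.mem_filter, Finset.mem_Icc, Finset.mem_Icc,
      hp.pow_dvd_iff_le_factorization hn]
    omega
  rw [h3, Nat.card_Icc]
  omega

lemma cardFactors_eq_sum_pow_dvd {n N K : ℕ} (hn : n ≠ 0) (hnN : n ≤ N) (hK : n < 2 ^ K) :
    ArithmeticFunction.cardFactors n
      = ∑ k ∈ Finset.Icc 1 K, ∑ p ∈ primesIoc 0 N, if p ^ k ∣ n then 1 else 0 := by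
  rw [Finset.sum_comm, ArithmeticFunction.cardFactors_eq_sum_factorization, Finsupp.sum]
  have h1 : n.factorization.support ⊆ primesIoc 0 N := by
    intro p hp
    rw [Nat.support_factorization, Nat.mem_primeFactors] at hp
    rw [mem_primesIoc]
    exact ⟨⟨hp.1.pos, (Nat.le_of_dvd (Nat.pos_of_ne_zero hn) hp.2.1).trans hnN⟩, hp.1⟩
  rw [Finset.sum_subset h1 fun p _ hp => Finsupp.notMem_support_iff.mp hp]
  exact Finset.sum_congr rfl fun p hp =>
    factorization_eq_sum_pow_dvd (mem_primesIoc.mp hp).2 hn hK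

lemma F_eq_sum_sumMultiples {N K : ℕ} (hK : N < 2 ^ K) (α : ℝ) :
    F N α = ∑ k ∈ Finset.Icc 1 K, ∑ p ∈ primesIoc 0 N, sumMultiples N α (p ^ k) := by
  have h1 : ∀ n ∈ Finset.Icc 1 N, (ArithmeticFunction.cardFactors n : ℂ) * e (α * n)
      = ∑ k ∈ Finset.Icc 1 K, ∑ p ∈ primesIoc 0 N, if p ^ k ∣ n then e (α * n) else 0 := by
    intro n hn
    rw [Finset.mem_Icc] at hn
    rw [cardFactors_eq_sum_pow_dvd (by omega) hn.2 (by omega : n < 2 ^ K)]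
    push_cast
    simp_rw [Finset.sum_mul, ite_mul, one_mul, zero_mul]
  rw [F, Finset.sum_congr rfl h1, Finset.sum_comm]
  refine Finset.sum_congr rfl fun k _ => ?_
  rw [Finset.sum_comm]
  refine Finset.sum_congr rfl fun p _ => ?_
  rw [sumMultiples, Finset.sum_filter]

/-- Two distinct primes above `D` dividing `n` would force `n ≥ (D + 1)² > N`. -/
lemma card_large_prime_dvd {n N D : ℕ} (hn : n ≠ 0) (hnN : n ≤ N) (hD : N < (D + 1) ^ 2) :
    ((primesIoc D N).filter (· ∣ n)).card = if n ∈ Nat.smoothNumbers (D + 1) then 0 else 1 := by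
  split_ifs with h
  · rw [Finset.card_eq_zero, Finset.filter_eq_empty_iff]
    intro p hp hpn
    obtain ⟨⟨h1, -⟩, hpp⟩ := mem_primesIoc.mp hp
    have := Nat.mem_smoothNumbers'.mp h p hpp hpn
    omega
  · rw [Nat.mem_smoothNumbers'] at h
    push Not at h
    obtain ⟨p, hpp, hpn, hDp⟩ := h
    rw [Finset.card_eq_one]
    refine ⟨p, ?_⟩
    ext r
    rw [Finset.mem_filter, mem_primesIoc, Finset.mem_singleton]
    constructor
    · rintro ⟨⟨⟨hr1, -⟩, hrp⟩, hrn⟩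
      by_contra hne
      have h1 : r * p ∣ n :=
        Nat.Coprime.mul_dvd_of_dvd_of_dvd ((Nat.coprime_primes hrp hpp).mpr hne) hrn hpn
      have h2 := Nat.le_of_dvd (Nat.pos_of_ne_zero hn) h1
      have h3 : (D + 1) ^ 2 ≤ r * p := by
        rw [sq]; exact Nat.mul_le_mul hr1 hDp
      omega
    · rintro rfl
      exact ⟨⟨⟨hDp, (Nat.le_of_dvd (Nat.pos_of_ne_zero hn) hpn).trans hnN⟩, hpp⟩, hpn⟩

lemma sum_large_primes_eq {N D : ℕ} (hD : N < (D + 1) ^ 2) (α : ℝ) :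
    ∑ p ∈ primesIoc D N, sumMultiples N α p
      = sumMultiples N α 1
        - ∑ n ∈ (Finset.Icc 1 N).filter (· ∈ Nat.smoothNumbers (D + 1)), e (α * n) := by
  unfold sumMultiples
  simp_rw [Finset.sum_filter, one_dvd, if_true]
  rw [Finset.sum_comm, ← Finset.sum_sub_distrib]
  refine Finset.sum_congr rfl fun n hn => ?_
  rw [Finset.mem_Icc] at hn
  rw [← Finset.sum_filter, Finset.sum_const, card_large_prime_dvd (by omega) hn.2 hD]
  split_ifs <;> simp

/-- For fixed `k` the powers `p^k` are distinct, so they embed in all `d ≤ D`. Forgetting primality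
costs only logarithms. -/
lemma sum_norm_small_pow_le (N D k : ℕ) (hk : k ≠ 0) (α : ℝ) (s : Finset ℕ)
    (hs : ∀ p ∈ s, p.Prime) :
    ∑ p ∈ s.filter (fun p => p ^ k ≤ D), ‖sumMultiples N α (p ^ k)‖
      ≤ ∑ d ∈ Finset.Icc 1 D, ‖sumMultiples N α d‖ := by
  rw [← Finset.sum_image (f := fun d => ‖sumMultiples N α d‖) (g := fun p => p ^ k)
    (fun x _ y _ h => Nat.pow_left_injective hk h)]
  refine Finset.sum_le_sum_of_subset_of_nonneg ?_ fun d _ _ => norm_nonneg _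
  intro d hd
  obtain ⟨p, hp, rfl⟩ := Finset.mem_image.mp hd
  rw [Finset.mem_filter] at hp
  rw [Finset.mem_Icc]
  exact ⟨Nat.pow_pos (hs p hp.1).pos, hp.2⟩

/-- Since `p^k > N/Q`, there are at most `Q` multiples of it up to `N`, and none unless `p ≤ √N`. -/
lemma sum_norm_large_pow_le {N D k : ℕ} {Q : ℝ} (hk : 2 ≤ k) (hQ : 0 < Q)
    (hD : N / Q < D + 1) (α : ℝ) :
    ∑ p ∈ (primesIoc 0 N).filter (fun p => ¬ p ^ k ≤ D), ‖sumMultiples N α (p ^ k)‖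
      ≤ √N * Q := by
  calc ∑ p ∈ (primesIoc 0 N).filter (fun p => ¬ p ^ k ≤ D), ‖sumMultiples N α (p ^ k)‖
      ≤ ∑ p ∈ (primesIoc 0 N).filter (fun p => ¬ p ^ k ≤ D), if p ≤ Nat.sqrt N then Q else 0 := by
        refine Finset.sum_le_sum fun p hp => ?_
        rw [Finset.mem_filter, mem_primesIoc, not_le] at hp
        obtain ⟨⟨⟨hp0, -⟩, -⟩, hpD⟩ := hp
        by_cases hpN : p ^ k ≤ N
        · have h1 : p ≤ Nat.sqrt N := by
            rw [Nat.le_sqrt']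
            exact (Nat.pow_le_pow_right hp0 hk).trans hpN
          rw [if_pos h1]
          refine (norm_sumMultiples_le N α (Nat.pow_pos hp0)).trans ?_
          have h2 : ((D + 1 : ℕ) : ℝ) ≤ ((p ^ k : ℕ) : ℝ) := by exact_mod_cast hpD
          have h3 : (N : ℝ) / Q < ((p ^ k : ℕ) : ℝ) := by push_cast at h2 ⊢; linarith
          have h4 : (0 : ℝ) < ((p ^ k : ℕ) : ℝ) := by positivity
          rw [div_lt_iff₀ hQ] at h3
          rw [div_le_iff₀ h4]
          linarith [mul_comm Q ((p ^ k : ℕ) : ℝ)]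
        · rw [sumMultiples_eq_zero α (by omega), norm_zero]
          split_ifs <;> positivity
    _ ≤ ∑ p ∈ Finset.Icc 1 (Nat.sqrt N), Q := by
        rw [← Finset.sum_filter]
        refine Finset.sum_le_sum_of_subset_of_nonneg ?_ fun _ _ _ => hQ.le
        intro p hp
        rw [Finset.mem_filter, Finset.mem_filter, mem_primesIoc] at hp
        rw [Finset.mem_Icc]
        exact ⟨hp.1.1.1.1, hp.2⟩
    _ = Nat.sqrt N * Q := by simp
    _ ≤ √N * Q := by
        gcongr
        exact Real.nat_sqrt_le_real_sqrt

lemma norm_F_le_of_smooth {N D K : ℕ} {Q : ℝ} (hD1 : 1 ≤ D) (hK : N < 2 ^ K)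
    (hQ : 0 < Q) (hDQ : N / Q < D + 1) (hD : N < (D + 1) ^ 2) (α : ℝ) :
    ‖F N α‖ ≤ (K + 1) * (∑ d ∈ Finset.Icc 1 D, ‖sumMultiples N α d‖) + K * (√N * Q)
      + ‖∑ n ∈ (Finset.Icc 1 N).filter (· ∈ Nat.smoothNumbers (D + 1)), e (α * n)‖ := by
  set T := ∑ d ∈ Finset.Icc 1 D, ‖sumMultiples N α d‖ with hT
  set S := ∑ n ∈ (Finset.Icc 1 N).filter (· ∈ Nat.smoothNumbers (D + 1)), e (α * n) with hS
  have hprime : ∀ p ∈ primesIoc 0 N, p.Prime := fun p hp => (mem_primesIoc.mp hp).2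
  have hT1 : ‖sumMultiples N α 1‖ ≤ T :=
    Finset.single_le_sum (f := fun d => ‖sumMultiples N α d‖) (fun _ _ => norm_nonneg _)
      (Finset.mem_Icc.mpr ⟨le_rfl, hD1⟩)
  have hlarge : (primesIoc 0 N).filter (fun p => ¬ p ^ 1 ≤ D) = primesIoc D N := by
    ext p
    rw [Finset.mem_filter, mem_primesIoc, mem_primesIoc, pow_one]
    constructor
    · rintro ⟨⟨h1, h2⟩, h3⟩; exact ⟨⟨by omega, h1.2⟩, h2⟩
    · rintro ⟨⟨h1, h3⟩, h2⟩; exact ⟨⟨⟨by omega, h3⟩, h2⟩, by omega⟩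
  have hsplit : ∀ k, ∑ p ∈ primesIoc 0 N, sumMultiples N α (p ^ k)
      = ∑ p ∈ (primesIoc 0 N).filter (fun p => p ^ k ≤ D), sumMultiples N α (p ^ k)
        + ∑ p ∈ (primesIoc 0 N).filter (fun p => ¬ p ^ k ≤ D), sumMultiples N α (p ^ k) :=
    fun k => (Finset.sum_filter_add_sum_filter_not _ _ _).symm
  have hk : ∀ k ∈ Finset.Icc 1 K, ‖∑ p ∈ primesIoc 0 N, sumMultiples N α (p ^ k)‖
      -- Only `k = 1` brings in the primes above `D`; the extra `T` bounds the sum of `e(αn)` over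
      -- all `n ≤ N`, its term `d = 1`.
      ≤ (T + √N * Q) + if k = 1 then T + ‖S‖ else 0 := by
    intro k hk
    rw [Finset.mem_Icc] at hk
    rw [hsplit k]
    refine (norm_add_le _ _).trans ?_
    have h1 := (norm_sum_le _ _).trans
      (sum_norm_small_pow_le N D k (by omega) α (primesIoc 0 N) hprime)
    have h0 : 0 ≤ √N * Q := by positivity
    by_cases hk1 : k = 1
    · subst hk1
      rw [hlarge, if_pos rfl]
      simp only [pow_one] at h1 ⊢
      rw [sum_large_primes_eq hD α]
      have h2 := norm_sub_le (sumMultiples N α 1) S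
      linarith
    · rw [if_neg hk1]
      have h2 := (norm_sum_le _ _).trans (sum_norm_large_pow_le (by omega : 2 ≤ k) hQ hDQ α)
      linarith
  rw [F_eq_sum_sumMultiples hK α]
  refine (norm_sum_le _ _).trans ((Finset.sum_le_sum hk).trans ?_)
  rw [Finset.sum_add_distrib, Finset.sum_const, Nat.card_Icc, nsmul_eq_mul, Finset.sum_ite_eq']
  have hT0 : 0 ≤ T := (norm_nonneg _).trans hT1
  have hS0 := norm_nonneg S
  split_ifs
  · push_cast [Nat.add_sub_cancel]; linarith
  · push_cast [Nat.add_sub_cancel]; linarith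

/-- The bound for `F` on a minor arc. -/
lemma norm_F_le {α : ℝ} {a : ℤ} {q : ℕ} (hq : 0 < q)
    (hc : IsCoprime a (q : ℤ)) (hα : |α - a / q| ≤ 1 / (q : ℝ) ^ 2) {N : ℕ} {Q : ℝ}
    (hN : 0 < N) (hQ : 1 ≤ Q) (hQq : Q ≤ q) (hqN : q ≤ N / Q) (hQN : Q ^ 2 ≤ √N)
    (hsm : (((Finset.Icc 1 N).filter (· ∈ Nat.smoothNumbers (⌊Q⌋₊ + 1))).card : ℝ) ≤ N / Q) :
    ‖F N α‖ ≤ 120 * (N / √Q) * (1 + Real.log (2 * N)) ^ 2 := by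
  set ℓ := 1 + Real.log (2 * N) with hℓ
  have hN1 : (1 : ℝ) ≤ N := by exact_mod_cast hN
  have hQ0 : 0 < Q := by linarith
  have hNQ : (N : ℝ) / Q ≤ N := div_le_self (by linarith) hQ
  have hℓ1 : 1 ≤ ℓ := by
    have := Real.log_nonneg (show (1 : ℝ) ≤ 2 * N by linarith)
    linarith
  have hsN : √N * √N = (N : ℝ) := Real.mul_self_sqrt (by linarith)
  have hsN1 : 1 ≤ √(N : ℝ) := Real.one_le_sqrt.mpr hN1
  have hNQ' : √N * Q ≤ N / Q := by
    rw [le_div_iff₀ hQ0]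
    nlinarith
  -- This gives `D + 1 > √N`, the condition for at most one prime factor above `D`.
  have hsNQ : √N ≤ N / Q := (le_mul_of_one_le_right (by positivity) hQ).trans hNQ'
  set D := ⌊(N : ℝ) / Q⌋₊ with hDdef
  have hD1 : 1 ≤ D := Nat.le_floor (by simpa using hsN1.trans hsNQ)
  have hDQ : (D : ℝ) ≤ N / Q := Nat.floor_le (by positivity)
  have hDQ' : (N : ℝ) / Q < D + 1 := Nat.lt_floor_add_one _
  have hDN : D ≤ N := by exact_mod_cast hDQ.trans hNQ
  have hDsq : N < (D + 1) ^ 2 := by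
    have : (N : ℝ) < (D + 1) ^ 2 := by nlinarith
    exact_mod_cast this
  have hqN' : q ≤ N := by exact_mod_cast hqN.trans hNQ
  have hB : Q / 2 ≤ (⌊Q⌋₊ : ℝ) := by
    have h1 := Nat.lt_floor_add_one Q
    have h2 : (1 : ℝ) ≤ (⌊Q⌋₊ : ℝ) := by exact_mod_cast Nat.le_floor (by simpa using hQ)
    linarith
  have hK := natLog_two_add_one_le hN
  have hF := norm_F_le_of_smooth (K := Nat.log 2 N + 1) hD1
    (Nat.lt_pow_succ_log_self (by norm_num) N) hQ0 hDQ' hDsq α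
  have hT := sum_norm_sumMultiples_le hq hc hα hN hqN' hDN
  have hS := norm_sum_smooth_le hq hc hα hN hQ hQq hqN hDQ hB
  rw [← hℓ] at hK hT hS
  set K : ℝ := ((Nat.log 2 N + 1 : ℕ) : ℝ) with hKdef
  have hK0 : 0 ≤ K := Nat.cast_nonneg _
  have hNq : (N : ℝ) / q ≤ N / Q := by gcongr
  have hT0 : 0 ≤ (N : ℝ) / Q := by positivity
  have hT' : ∑ d ∈ Finset.Icc 1 D, ‖sumMultiples N α d‖ ≤ 24 * (N / Q) * ℓ := by
    refine hT.trans ?_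
    have : 8 * (N / q + D + q) ≤ 24 * ((N : ℝ) / Q) := by linarith
    gcongr
  have hNQs : (N : ℝ) / Q ≤ N / √Q := by
    gcongr
    rw [Real.sqrt_le_left hQ0.le]
    nlinarith
  have hℓ2 : ℓ ≤ ℓ ^ 2 := by nlinarith
  calc ‖F N α‖ ≤ _ := hF
    _ ≤ (2 * ℓ + ℓ) * (24 * (N / Q) * ℓ) + 2 * ℓ * (N / Q)
        + (N / Q + 4 * (N / Q) + 12 * (N / √Q) * ℓ ^ 2) := by
      gcongr
      exact hS.trans (by gcongr)
    _ = 72 * (N / Q) * ℓ ^ 2 + 2 * (N / Q) * ℓ + 5 * (N / Q) * 1 + 12 * (N / √Q) * ℓ ^ 2 := by ring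
    _ ≤ 72 * (N / √Q) * ℓ ^ 2 + 2 * (N / √Q) * ℓ ^ 2 + 5 * (N / √Q) * ℓ ^ 2
        + 12 * (N / √Q) * ℓ ^ 2 := by
      gcongr
      linarith
    _ ≤ _ := by
      have : 0 ≤ (N : ℝ) / √Q * ℓ ^ 2 := by positivity
      linarith

/-! ### The minor arcs: measurability and Dirichlet approximation. -/

lemma measurableSet_minorArcs (B : ℝ) (N : ℕ) : MeasurableSet (minorArcs B N) := by
  refine measurableSet_Icc.diff ?_
  have h : majorArcs B N = ⋃ q : ℕ, ⋃ a : ℕ,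
      {_α : ℝ | 1 ≤ q ∧ (q : ℝ) ≤ arcParam B N ∧ a ≤ q ∧ Nat.Coprime a q} ∩ majorArc B N q a := by
    ext α
    simp only [majorArcs, Set.mem_ofPred_eq, Set.mem_iUnion, Set.mem_inter_iff, and_assoc]
  rw [h]
  refine MeasurableSet.iUnion fun q => MeasurableSet.iUnion fun a =>
    (MeasurableSet.const _).inter ?_
  refine measurableSet_Icc.inter ?_
  exact (isClosed_le (continuous_id.sub continuous_const).abs continuous_const).measurableSet

/-- Dirichlet's theorem on a minor arc: the denominator lies between `Q` and `N / Q`. -/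
lemma exists_approx_of_mem_minorArcs {B α : ℝ} {N : ℕ} (hN : 0 < N)
    (hQ : 1 ≤ arcParam B N) (hQN : arcParam B N ≤ N) (hα : α ∈ minorArcs B N) :
    ∃ (a : ℤ) (q : ℕ), 0 < q ∧ IsCoprime a (q : ℤ) ∧ |α - a / q| ≤ 1 / (q : ℝ) ^ 2 ∧
      arcParam B N ≤ q ∧ q ≤ N / arcParam B N := by
  set Q := arcParam B N with hQdef
  have hN0 : (0 : ℝ) < N := by exact_mod_cast hN
  have hQ0 : 0 < Q := by linarith
  set n := ⌊(N : ℝ) / Q⌋₊ with hn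
  have hn1 : 1 ≤ n := Nat.le_floor (by rw [Nat.cast_one, one_le_div hQ0]; exact hQN)
  have hnle : (n : ℝ) ≤ N / Q := Nat.floor_le (by positivity)
  have hnlt : (N : ℝ) / Q < n + 1 := Nat.lt_floor_add_one _
  obtain ⟨r, hr, hrn⟩ := Real.exists_rat_abs_sub_le_and_den_le α hn1
  have hq0 : 0 < r.den := r.den_pos
  have hq0' : (0 : ℝ) < r.den := by exact_mod_cast hq0
  have hq1 : (1 : ℝ) ≤ r.den := by exact_mod_cast hq0
  have hrnR : (r.den : ℝ) ≤ n := by exact_mod_cast hrn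
  have hn1R : (1 : ℝ) ≤ n := by exact_mod_cast hn1
  rw [Rat.cast_def] at hr
  have hcop : IsCoprime r.num (r.den : ℤ) := Int.isCoprime_iff_gcd_eq_one.mpr r.reduced
  refine ⟨r.num, r.den, hq0, hcop, ?_, ?_, hrnR.trans hnle⟩
  · refine hr.trans ?_
    rw [sq]
    gcongr
    linarith
  · by_contra hlt
    push Not at hlt
    obtain ⟨hαI, hmaj⟩ := hα
    apply hmaj
    -- An error strictly below `1/r.den` forces `0 ≤ r.num ≤ r.den` for `α ∈ [0, 1]`, so the
    -- fraction is an admissible centre of a major arc.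
    have hlt1 : 1 / ((n + 1) * r.den : ℝ) < 1 / r.den := by
      apply one_div_lt_one_div_of_lt hq0'
      nlinarith
    have hr' := abs_lt.mp (hr.trans_lt hlt1)
    have hnum0 : 0 ≤ r.num := by
      by_contra hneg
      have h1 : (r.num : ℝ) ≤ -1 := by exact_mod_cast (by omega : r.num ≤ -1)
      have h2 : (r.num : ℝ) / r.den ≤ (-1) / r.den := by gcongr
      rw [neg_div] at h2
      linarith [hαI.1, hr'.2]
    have hnumq : r.num ≤ r.den := by
      by_contra hneg
      have h1 : (r.den : ℝ) + 1 ≤ r.num := by exact_mod_cast (by omega : (r.den : ℤ) + 1 ≤ r.num)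
      have h2 : ((r.den : ℝ) + 1) / r.den ≤ r.num / r.den := by gcongr
      rw [add_div, div_self hq0'.ne'] at h2
      linarith [hαI.2, hr'.1]
    obtain ⟨a, ha⟩ := Int.eq_ofNat_of_zero_le hnum0
    refine ⟨r.den, a, hq0, hlt.le, by omega, ?_, hαI, ?_⟩
    · have := r.reduced
      rwa [ha, Int.natAbs_natCast] at this
    · have h1 : (r.num : ℝ) = a := by rw [ha]; simp
      rw [h1] at hr
      refine hr.trans ?_
      rw [← hQdef]
      have h2 : 1 / ((n + 1) * r.den : ℝ) ≤ 1 / (N / Q) := by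
        have : 0 < (N : ℝ) / Q := by positivity
        gcongr
        nlinarith
      rwa [one_div_div] at h2

/-! ### Parseval and the cubic integral. -/

lemma continuous_F (N : ℕ) : Continuous (F N) := by
  unfold F
  refine continuous_finsetSum _ fun n _ => continuous_const.mul ?_
  exact continuous_e.comp (by fun_prop)

lemma integral_e_mul_int (k : ℤ) : ∫ α in (0 : ℝ)..1, e (α * k) = if k = 0 then 1 else 0 := by
  split_ifs with h
  · subst h
    simp [e]
  · have hc : (2 * Real.pi * Complex.I * k : ℂ) ≠ 0 := by
      have h1 : (k : ℂ) ≠ 0 := by exact_mod_cast h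
      have h2 : (Real.pi : ℂ) ≠ 0 := by exact_mod_cast Real.pi_ne_zero
      exact mul_ne_zero (mul_ne_zero (mul_ne_zero two_ne_zero h2) Complex.I_ne_zero) h1
    have h1 : ∀ α : ℝ, e (α * k) = Complex.exp (2 * Real.pi * Complex.I * k * α) := by
      intro α
      unfold e
      congr 1
      push_cast
      ring
    simp_rw [h1]
    rw [integral_exp_mul_complex hc]
    have h2 : Complex.exp (2 * Real.pi * Complex.I * k * ((1 : ℝ) : ℂ)) = 1 := by
      rw [← h1, one_mul, e_intCast]
    rw [h2]
    simp

/-- Parseval's identity for `F`. -/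
lemma integral_norm_F_sq (N : ℕ) :
    ∫ α in (0 : ℝ)..1, ‖F N α‖ ^ 2
      = ∑ n ∈ Finset.Icc 1 N, (ArithmeticFunction.cardFactors n : ℝ) ^ 2 := by
  have h1 : ∀ α : ℝ, ((‖F N α‖ ^ 2 : ℝ) : ℂ)
      = ∑ n ∈ Finset.Icc 1 N, ∑ m ∈ Finset.Icc 1 N,
        ((ArithmeticFunction.cardFactors n : ℂ) * ArithmeticFunction.cardFactors m)
          * e (α * ((n : ℤ) - m : ℤ)) := by
    intro α
    push_cast
    rw [← Complex.mul_conj', F, map_sum, Finset.sum_mul_sum]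
    refine Finset.sum_congr rfl fun n _ => Finset.sum_congr rfl fun m _ => ?_
    rw [map_mul, conj_e, Complex.conj_natCast]
    have : e (α * ((n : ℝ) - m)) = e (α * n) * e (-(α * m)) := by
      rw [← e_add]; congr 1; ring
    rw [this]
    ring
  have hcont : ∀ (c : ℂ) (k : ℤ), Continuous fun α : ℝ => c * e (α * k) := fun c k =>
    continuous_const.mul (continuous_e.comp (by fun_prop))
  have h2 : ((∫ α in (0 : ℝ)..1, ‖F N α‖ ^ 2 : ℝ) : ℂ)
      = ((∑ n ∈ Finset.Icc 1 N, (ArithmeticFunction.cardFactors n : ℝ) ^ 2 : ℝ) : ℂ) := by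
    rw [← intervalIntegral.integral_ofReal]
    simp_rw [h1]
    rw [intervalIntegral.integral_finsetSum fun n _ =>
      (continuous_finsetSum _ fun m _ => hcont _ _).intervalIntegrable _ _]
    rw [Complex.ofReal_sum]
    refine Finset.sum_congr rfl fun n hn => ?_
    rw [intervalIntegral.integral_finsetSum fun m _ => (hcont _ _).intervalIntegrable _ _]
    simp_rw [intervalIntegral.integral_const_mul, integral_e_mul_int]
    rw [Finset.sum_eq_single_of_mem n hn]
    · simp [sq]
    · intro m _ hm
      have : (n : ℤ) - m ≠ 0 := by omega
      simp [this]
  exact_mod_cast h2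

lemma cardFactors_le_of_lt_two_pow {n K : ℕ} (hn : n ≠ 0) (hK : n < 2 ^ K) :
    ArithmeticFunction.cardFactors n ≤ K := by
  rw [ArithmeticFunction.cardFactors_apply]
  have h1 : 2 ^ n.primeFactorsList.length ≤ n.primeFactorsList.prod :=
    List.pow_card_le_prod _ _ fun p hp => (Nat.prime_of_mem_primeFactorsList hp).two_le
  rw [Nat.prod_primeFactorsList hn] at h1
  exact ((Nat.pow_lt_pow_iff_right (by norm_num)).mp (h1.trans_lt hK)).le

lemma integral_norm_F_sq_le {N : ℕ} (hN : 0 < N) :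
    ∫ α in (0 : ℝ)..1, ‖F N α‖ ^ 2 ≤ N * (2 * (1 + Real.log (2 * N))) ^ 2 := by
  rw [integral_norm_F_sq]
  calc ∑ n ∈ Finset.Icc 1 N, (ArithmeticFunction.cardFactors n : ℝ) ^ 2
      ≤ ∑ n ∈ Finset.Icc 1 N, (2 * (1 + Real.log (2 * N))) ^ 2 := by
        refine Finset.sum_le_sum fun n hn => ?_
        rw [Finset.mem_Icc] at hn
        have h1 : ArithmeticFunction.cardFactors n ≤ Nat.log 2 N + 1 :=
          cardFactors_le_of_lt_two_pow (by omega)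
            (hn.2.trans_lt (Nat.lt_pow_succ_log_self (by norm_num) N))
        have h2 : (ArithmeticFunction.cardFactors n : ℝ) ≤ ((Nat.log 2 N + 1 : ℕ) : ℝ) := by
          exact_mod_cast h1
        gcongr
        exact h2.trans (natLog_two_add_one_le hN)
    _ = _ := by simp

lemma norm_integral_minorArcs_le {B : ℝ} {N : ℕ} {S : ℝ} (hS0 : 0 ≤ S)
    (hS : ∀ α ∈ minorArcs B N, ‖F N α‖ ≤ S) :
    ‖∫ α in minorArcs B N, F N α ^ 3 * e (-(α * (N : ℝ)))‖
      ≤ S * ∫ α in (0 : ℝ)..1, ‖F N α‖ ^ 2 := by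
  have hcont : Continuous fun α : ℝ => ‖F N α‖ ^ 2 := (continuous_F N).norm.pow 2
  have hint : MeasureTheory.IntegrableOn (fun α : ℝ => ‖F N α‖ ^ 2) (Set.Icc 0 1) :=
    hcont.integrableOn_Icc
  have hsub : minorArcs B N ⊆ Set.Icc 0 1 := Set.sdiff_subset
  calc ‖∫ α in minorArcs B N, F N α ^ 3 * e (-(α * (N : ℝ)))‖
      ≤ ∫ α in minorArcs B N, S * ‖F N α‖ ^ 2 := by
        refine MeasureTheory.norm_integral_le_of_norm_le ((hint.mono_set hsub).const_mul S) ?_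
        refine MeasureTheory.ae_restrict_of_forall_mem (measurableSet_minorArcs B N) fun α hα => ?_
        rw [norm_mul, norm_e, mul_one, norm_pow, pow_succ, mul_comm]
        gcongr
        exact hS α hα
    _ = S * ∫ α in minorArcs B N, ‖F N α‖ ^ 2 := MeasureTheory.integral_const_mul _ _
    _ ≤ S * ∫ α in Set.Icc (0 : ℝ) 1, ‖F N α‖ ^ 2 := by
        refine mul_le_mul_of_nonneg_left ?_ hS0
        exact MeasureTheory.setIntegral_mono_set hint
          (Filter.Eventually.of_forall fun α => sq_nonneg _) hsub.eventuallyLE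
    _ = _ := by
        rw [MeasureTheory.integral_Icc_eq_integral_Ioc,
          intervalIntegral.integral_of_le zero_le_one]

/-! ### Large `N` and conclusion. -/

/-- With `t = log Q` and `log k ≤ 2t`, Rankin's exponent is at most `-37t + 12(1 + 2t) = 12 - 13t`,
which is at most `-t` because `t ≥ 1`; the `74` is `2 · 37`. -/
lemma card_smoothNumbers_floor_le {N : ℕ} {Q : ℝ} (hN : 0 < N) (hQ : 8 ≤ Q)
    (hlog : 74 * Real.log Q ^ 2 ≤ Real.log N) :
    (((Finset.Icc 1 N).filter (· ∈ Nat.smoothNumbers (⌊Q⌋₊ + 1))).card : ℝ) ≤ N / Q := by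
  have hQ0 : 0 < Q := by linarith
  have hl2 := Real.log_two_gt_d9
  have hl2' := Real.log_two_lt_d9
  have hl8 : Real.log 8 = 3 * Real.log 2 := by
    rw [show (8 : ℝ) = 2 ^ 3 by norm_num, Real.log_pow]; norm_num
  have hlQ : Real.log 8 ≤ Real.log Q := Real.log_le_log (by norm_num) hQ
  set t := Real.log Q with ht
  set k := ⌊Q⌋₊ + 1 with hk
  have hkQ : Q ≤ k := by rw [hk]; push_cast; exact (Nat.lt_floor_add_one Q).le
  have hkQ2 : (k : ℝ) ≤ 2 * Q := by
    have := Nat.floor_le hQ0.le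
    rw [hk]; push_cast; linarith
  have h1 : t ≤ Real.log k := Real.log_le_log hQ0 hkQ
  have h2 : Real.log k ≤ 2 * t := by
    have := Real.log_le_log (by linarith) hkQ2
    rw [Real.log_mul (by norm_num) hQ0.ne'] at this
    linarith
  refine (card_smoothNumbers_le N k hN (by linarith)).trans ?_
  have hQinv : Q⁻¹ = Real.exp (-t) := by rw [Real.exp_neg, ht, Real.exp_log hQ0]
  rw [mul_assoc, ← Real.exp_add, div_eq_mul_inv (N : ℝ) Q, hQinv]
  refine mul_le_mul_of_nonneg_left (Real.exp_le_exp.mpr ?_) (Nat.cast_nonneg N)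
  have h3 : 37 * t ≤ Real.log N / Real.log k := by
    rw [le_div_iff₀ (by linarith)]
    nlinarith
  linarith

lemma eventually_arcParam {B : ℝ} (hB : 0 < B) :
    ∀ᶠ N : ℕ in Filter.atTop, 0 < N ∧ 1 ≤ Real.log N ∧ 1 ≤ Real.log (Real.log N) ∧
      8 ≤ arcParam B N ∧ arcParam B N ^ 2 ≤ √N ∧
      74 * Real.log (arcParam B N) ^ 2 ≤ Real.log N := by
  have hL : Filter.Tendsto (fun N : ℕ => Real.log N) Filter.atTop Filter.atTop :=
    Real.tendsto_log_atTop.comp tendsto_natCast_atTop_atTop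
  have hLL := Real.tendsto_log_atTop.comp hL
  have hQ := (tendsto_rpow_atTop hB).comp hL
  have h2 := ((isLittleO_log_rpow_rpow_atTop (2 * B) (by norm_num : (0 : ℝ) < 1 / 2)).bound
    one_pos)
  have h3 := (Real.isLittleO_pow_log_id_atTop (n := 2)).bound
    (by positivity : 0 < 1 / (74 * B ^ 2))
  filter_upwards [Filter.eventually_gt_atTop 0, hL.eventually_ge_atTop 1,
    hLL.eventually_ge_atTop 1, hQ.eventually_ge_atTop 8, tendsto_natCast_atTop_atTop.eventually h2,
    hL.eventually h3] with N hN hN1 hN2 hN8 hN4 hN5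
  have hL0 : 0 < Real.log N := by linarith
  refine ⟨hN, hN1, hN2, hN8, ?_, ?_⟩
  · rw [Real.norm_of_nonneg (by positivity), Real.norm_of_nonneg (by positivity), one_mul,
      ← Real.sqrt_eq_rpow] at hN4
    refine le_trans (le_of_eq ?_) hN4
    rw [arcParam, ← Real.rpow_natCast, ← Real.rpow_mul hL0.le]
    congr 1
    push_cast
    ring
  · rw [arcParam, Real.log_rpow hL0, mul_pow]
    rw [Real.norm_of_nonneg (by positivity), id, Real.norm_of_nonneg hL0.le, one_div,
      inv_mul_eq_div, le_div_iff₀ (by positivity)] at hN5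
    linarith

theorem theorem4 (B : ℝ) (hB : 0 < B) :
    ∃ C : ℝ, 0 < C ∧ ∃ N₀ : ℕ, ∀ Δ : ℝ, 0 < Δ → Δ < 1 / 2 → ∀ N : ℕ, N₀ ≤ N →
      ‖∫ α in minorArcs B N, F N α ^ 3 * e (-(α * (N : ℝ)))‖ ≤
        C * ((N : ℝ) ^ 2 * Real.log (Real.log N) ^ 2 / Real.log N ^ (B * Δ - 4)) := by
  obtain ⟨N₀, hN₀⟩ := Filter.eventually_atTop.mp (eventually_arcParam hB)
  -- `38880 = 120 · 3² · 6²`, from the pointwise bound, `ℓ ≤ 3 log N`, and Parseval.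
  refine ⟨38880, by norm_num, N₀, fun Δ _ hΔ N hN => ?_⟩
  obtain ⟨hN0, hL1, hLL1, hQ8, hQN, hQlog⟩ := hN₀ N hN
  set L := Real.log N with hL
  set Q := arcParam B N with hQ
  have hNR : (1 : ℝ) ≤ N := by exact_mod_cast hN0
  have hL0 : 0 < L := by linarith
  have hQ1 : 1 ≤ Q := by linarith
  have hQN' : Q ≤ N := by
    have h1 : √(N : ℝ) ≤ N := by
      rw [Real.sqrt_le_left (by linarith)]
      nlinarith
    nlinarith
  have hsm := card_smoothNumbers_floor_le hN0 hQ8 hQlog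
  have hsup : ∀ α ∈ minorArcs B N,
      ‖F N α‖ ≤ 120 * (N / √Q) * (1 + Real.log (2 * N)) ^ 2 := by
    intro α hα
    obtain ⟨a, q, hq, hc, hαq, hQq, hqN⟩ := exists_approx_of_mem_minorArcs hN0 hQ1 hQN' hα
    exact norm_F_le hq hc hαq hN0 hQ1 hQq hqN hQN hsm
  have hℓ : 1 + Real.log (2 * N) ≤ 3 * L := by
    rw [Real.log_mul (by norm_num) (by linarith)]
    linarith [Real.log_two_lt_d9]
  have hℓ0 : 0 ≤ 1 + Real.log (2 * N) := by
    have := Real.log_nonneg (show (1 : ℝ) ≤ 2 * N by linarith)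
    linarith
  -- The only use of `Δ < 1/2`: `√Q = L^(B/2)` and `L ≥ 1`.
  have hsqrt : L ^ (B * Δ) ≤ √Q := by
    rw [hQ, arcParam, Real.sqrt_eq_rpow, ← Real.rpow_mul hL0.le]
    exact Real.rpow_le_rpow_of_exponent_le hL1 (by nlinarith)
  have hLpow : 0 < L ^ (B * Δ) := by positivity
  calc ‖∫ α in minorArcs B N, F N α ^ 3 * e (-(α * (N : ℝ)))‖
      ≤ 120 * (N / √Q) * (1 + Real.log (2 * N)) ^ 2 * ∫ α in (0 : ℝ)..1, ‖F N α‖ ^ 2 :=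
        norm_integral_minorArcs_le (by positivity) hsup
    _ ≤ 120 * (N / √Q) * (1 + Real.log (2 * N)) ^ 2
          * (N * (2 * (1 + Real.log (2 * N))) ^ 2) := by
        gcongr
        exact integral_norm_F_sq_le hN0
    _ ≤ 120 * (N / L ^ (B * Δ)) * (3 * L) ^ 2 * (N * (2 * (3 * L)) ^ 2) := by gcongr
    _ = 38880 * ((N : ℝ) ^ 2 * 1 ^ 2 / L ^ (B * Δ - 4)) := by
        have h4 : L ^ (4 : ℝ) = L ^ 4 := by exact_mod_cast Real.rpow_natCast L 4
        rw [Real.rpow_sub hL0, h4]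
        field_simp
        norm_num
    _ ≤ _ := by gcongr
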